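/- Let $g,P\in\mathbb R$ with $0<g^2\le 1$ and $P\ge 0$. Consider the two-user symmetric real Gaussian interference channel $$Y_1=X_1+gX_2+Z_1,\qquad Y_2=X_2+gX_1+Z_2,$$ used $n$ times without memory, where $Z_1$ and $Z_2$ are $\mathcal N(0,1)$ noises, i.i.d. over time and independent of the inputs, and every codeword of both users satisfies $\|x_i^n\|^2\le nP$. The messages are independent and uniformly distributed over $[1:2^{nR_1}]$ and $[1:2^{nR_2}]$. A pair of rates $R_1,R_2\ge 0$ is achievable if there is a sequence of $(2^{nR_1},2^{nR_2})$ codes whose average error probabilities at both receivers tend to $0$ as $n\to\infty$. The capacity region is the closure of the set of achievable pairs. All logarithms are to base $2$. Put $$R^*_{\mathrm{sym}}=\tfrac12\log\bigl(|g|P+|g|^{-1}(P+1)\bigr),\qquad \sigma^2=\begin{cases}4g^2(1-g^2)&\text{if } g^2\le 0.5,\\ 1&\text{otherwise.}\end{cases}$$ Then the sum rate $R=R_1+R_2$ of every pair $(R_1,R_2)$ in the capacity region satisfies $$R\le R^*_{\mathrm{sym}}+\min\left(\tfrac14\log\frac{g^2P+\sigma^2}{g^2P+1}+\tfrac14\log\frac{4g^4}{\sigma^2(4g^2-\sigma^2)},\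 \ \tfrac12\log\frac{4g^2+1}{4|g|}\right).$$ -/

import Mathlib

open MeasureTheory ProbabilityTheory Filter Topology

noncomputable section

/-- A block code of length `n`, with `M₁` and `M₂` messages, for a two-user real interference
channel under the average power constraint `‖xᵢⁿ‖² ≤ n P` on every codeword of both users. -/
structure GICCode (n M₁ M₂ : ℕ) (P : ℝ) where
  enc₁ : Fin M₁ → Fin n → ℝ
  enc₂ : Fin M₂ → Fin n → ℝ
  power₁ : ∀ m, ∑ t, enc₁ m t ^ 2 ≤ n * P
  power₂ : ∀ m, ∑ t, enc₂ m t ^ 2 ≤ n * P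
  dec₁ : (Fin n → ℝ) → Fin M₁
  dec₂ : (Fin n → ℝ) → Fin M₂
  measurable_dec₁ : Measurable dec₁
  measurable_dec₂ : Measurable dec₂

/-- The law of `n` i.i.d. `𝒩(0,1)` noise samples. -/
def noiseLaw (n : ℕ) : Measure (Fin n → ℝ) :=
  Measure.pi fun _ => gaussianReal 0 1

/-- The average probability of error at receiver 1, which observes
`Y₁ = X₁ + g X₂ + Z₁`, for independent and uniformly distributed messages. -/
def GICCode.avgError₁ {n M₁ M₂ : ℕ} {P : ℝ} (c : GICCode n M₁ M₂ P) (g : ℝ) : ℝ :=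
  (∑ m₁, ∑ m₂, (noiseLaw n).real
    {z | c.dec₁ (fun t => c.enc₁ m₁ t + g * c.enc₂ m₂ t + z t) ≠ m₁}) / (M₁ * M₂)

/-- The average probability of error at receiver 2, which observes
`Y₂ = X₂ + g X₁ + Z₂`, for independent and uniformly distributed messages. -/
def GICCode.avgError₂ {n M₁ M₂ : ℕ} {P : ℝ} (c : GICCode n M₁ M₂ P) (g : ℝ) : ℝ :=
  (∑ m₁, ∑ m₂, (noiseLaw n).real
    {z | c.dec₂ (fun t => c.enc₂ m₂ t + g * c.enc₁ m₁ t + z t) ≠ m₂}) / (M₁ * M₂)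

/-- The number of messages in `[1 : 2^{nR}]`. -/
def messageCount (n : ℕ) (R : ℝ) : ℕ := ⌊(2 : ℝ) ^ ((n : ℝ) * R)⌋₊

/-- `(R₁, R₂)` is achievable on the symmetric real Gaussian interference channel with cross gain
`g` and power `P`: some sequence of `(2^{nR₁}, 2^{nR₂})` codes has average error probabilities
tending to zero at both receivers. -/
def GICAchievable (g P R₁ R₂ : ℝ) : Prop :=
  0 ≤ R₁ ∧ 0 ≤ R₂ ∧
    ∃ c : ∀ n : ℕ, GICCode n (messageCount n R₁) (messageCount n R₂) P,
      Tendsto (fun n => (c n).avgError₁ g) atTop (𝓝 0) ∧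
      Tendsto (fun n => (c n).avgError₂ g) atTop (𝓝 0)

/-- The capacity region: the closure of the set of achievable rate pairs. -/
def gicCapacityRegion (g P : ℝ) : Set (ℝ × ℝ) :=
  closure {R | GICAchievable g P R.1 R.2}

/-- `R*_sym = ½ log₂ (|g| P + |g|⁻¹ (P + 1))`. -/
def rateSym (g P : ℝ) : ℝ :=
  1 / 2 * Real.logb 2 (|g| * P + |g|⁻¹ * (P + 1))

/-- The genie noise variance `σ²`. -/
def sigmaSq (g : ℝ) : ℝ :=
  if g ^ 2 ≤ 1 / 2 then 4 * g ^ 2 * (1 - g ^ 2) else 1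

end

/-! Fix a code, let X₁, X₂ be uniform codewords, and write hᵢ(v) for the differential entropy of gXᵢ
plus white Gaussian noise of variance v (`mixEntropy`). The converse adds inequalities for a single
code in which the unknown entropies cancel or can be compared.

Receiver 1 alone gives log M₁ ≲ h(Y₁) − h₂(1), where h(Y₁) is at most the Gaussian entropy at
variance (1+g²)P+1 (`log_mul_le_direct`); user 2 is symmetric. To cancel −h₁(1) − h₂(1), a genie
gives receiver 1 the signal S = gX₁ + N, where the channel noise is Z₁ = N/(2g) + K with K
independent of N. The coefficient 1/(2g) is chosen because Y₁ − S/g = gX₂ + K − N/(2g) then again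
has noise of variance 1, and so contributes h₂(1).

If only X₁ is decoded and N, K have equal variance s, what remains is h₁(s) − h₂(s)
(`log_mul_le_side_info`), which cancels against the other user's bound. This is the second term of
the minimum. If instead Var K ≤ g², both messages can be decoded from (S, Y₁): X₁ reveals N, leaving
X₂ + K/g, which is no noisier than receiver 2's view of X₂ (`log_add_log_mul_le`). What remains is
h₁(v) − h₁(1), with v = Var N, controlled because Gaussian noise is the worst additive noise
(`mixEntropy_sub_le`). This is the first term.

Every information inequality comes from Gibbs' inequality (`integral_log_sub_le`) with a product
comparison density, `fano_inequality` included. The loss per inequality is a constant number of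
nats, which vanishes after division by n (`GICAchievable.sum_le`). -/

noncomputable section

open scoped NNReal ENNReal

/-! ### White Gaussian vectors: densities, second moments, entropy -/

/-- The law of `n` i.i.d. centred Gaussian variables of variance `s`. -/
def gaussVec (n : ℕ) (s : ℝ≥0) : Measure (Fin n → ℝ) := Measure.pi fun _ => gaussianReal 0 s

instance isProbabilityMeasure_gaussVec (n : ℕ) (s : ℝ≥0) :
    IsProbabilityMeasure (gaussVec n s) := by
  unfold gaussVec; infer_instance

lemma noiseLaw_eq_gaussVec (n : ℕ) : noiseLaw n = gaussVec n 1 := rfl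

/-- The density of `gaussVec n s`. -/
def gaussVecPDF {n : ℕ} (s : ℝ≥0) (x : Fin n → ℝ) : ℝ := ∏ t, gaussianPDFReal 0 s (x t)

lemma gaussVecPDF_pos {n : ℕ} {s : ℝ≥0} (hs : s ≠ 0) (x : Fin n → ℝ) : 0 < gaussVecPDF s x :=
  Finset.prod_pos fun _ _ => gaussianPDFReal_pos _ _ _ hs

@[fun_prop]
lemma measurable_gaussVecPDF {n : ℕ} (s : ℝ≥0) : Measurable (gaussVecPDF (n := n) s) := by
  unfold gaussVecPDF
  exact Finset.measurable_prod _ fun t _ =>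
    (measurable_gaussianPDFReal 0 s).comp (measurable_pi_apply t)

lemma withDensity_pi {ι : Type*} [Fintype ι] {f : ι → ℝ → ℝ} (hf : ∀ i x, 0 ≤ f i x)
    (hi : ∀ i, Integrable (f i)) :
    (volume.withDensity fun x : ι → ℝ => ENNReal.ofReal (∏ i, f i (x i))) =
      Measure.pi fun i => volume.withDensity fun x => ENNReal.ofReal (f i x) := by
  classical
  have : ∀ i, IsFiniteMeasure (volume.withDensity fun x => ENNReal.ofReal (f i x)) := fun i =>
    isFiniteMeasure_withDensity_ofReal (hi i).2
  symm
  refine Measure.pi_eq fun S hS => ?_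
  have hbox : MeasurableSet (Set.univ.pi S) := MeasurableSet.univ_pi hS
  rw [withDensity_apply _ hbox, ← lintegral_indicator hbox]
  have e : ∀ x : ι → ℝ, (Set.univ.pi S).indicator
      (fun x : ι → ℝ => ENNReal.ofReal (∏ i, f i (x i))) x =
      ENNReal.ofReal (∏ i, (S i).indicator (f i) (x i)) := by
    intro x
    by_cases hx : x ∈ Set.univ.pi S
    · rw [Set.indicator_of_mem hx]
      congr 1
      refine Finset.prod_congr rfl fun i _ => ?_
      rw [Set.indicator_of_mem (hx i (Set.mem_univ i))]
    · rw [Set.indicator_of_notMem hx]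
      simp only [Set.mem_univ_pi, not_forall] at hx
      obtain ⟨i, hi⟩ := hx
      rw [Finset.prod_eq_zero (Finset.mem_univ i) (Set.indicator_of_notMem hi _)]
      simp
  simp_rw [e]
  have hnn : ∀ i x, 0 ≤ (S i).indicator (f i) x := fun i x =>
    Set.indicator_nonneg (fun x _ => hf i x) x
  have hii : ∀ i, Integrable ((S i).indicator (f i)) := fun i => (hi i).indicator (hS i)
  have hprod : Integrable (fun x : ι → ℝ => ∏ i, (S i).indicator (f i) (x i)) := by
    rw [volume_pi]; exact Integrable.fintype_prod hii
  rw [← ofReal_integral_eq_lintegral_ofReal hprod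
    (Eventually.of_forall fun x => Finset.prod_nonneg fun i _ => hnn i _),
    integral_fintype_prod_volume_eq_prod,
    ENNReal.ofReal_prod_of_nonneg fun i _ => integral_nonneg (hnn i)]
  refine Finset.prod_congr rfl fun i _ => ?_
  rw [withDensity_apply _ (hS i), ofReal_integral_eq_lintegral_ofReal (hii i)
    (Eventually.of_forall (hnn i)), ← lintegral_indicator (hS i)]
  refine lintegral_congr fun x => ?_
  by_cases hx : x ∈ S i <;> simp [hx]

lemma gaussVec_eq_withDensity (n : ℕ) {s : ℝ≥0} (hs : s ≠ 0) :
    gaussVec n s = volume.withDensity fun x => ENNReal.ofReal (gaussVecPDF s x) := by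
  unfold gaussVecPDF
  rw [withDensity_pi (fun _ => gaussianPDFReal_nonneg 0 s)
    (fun _ => integrable_gaussianPDFReal 0 s)]
  simp only [gaussVec, gaussianReal_of_var_ne_zero 0 hs]
  rfl

/-- A linear combination of independent Gaussian vectors is a Gaussian vector. -/
lemma measurePreserving_linearComb_gaussVec (n : ℕ) {s r u : ℝ≥0} {a b : ℝ}
    (h : (u : ℝ) = a ^ 2 * s + b ^ 2 * r) :
    MeasurePreserving (fun p : (Fin n → ℝ) × (Fin n → ℝ) => a • p.1 + b • p.2)
      ((gaussVec n s).prod (gaussVec n r)) (gaussVec n u) := by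
  have h1 : ((gaussianReal 0 s).prod (gaussianReal 0 r)).map
      (fun q : ℝ × ℝ => a * q.1 + b * q.2) = gaussianReal 0 u := by
    have h2 : ∀ (c : ℝ) (v : ℝ≥0), (gaussianReal 0 v).map (c * ·) =
        gaussianReal 0 (.mk (c ^ 2) (sq_nonneg c) * v) := fun c v => by
      rw [gaussianReal_map_const_mul, mul_zero]
    have h3 := @gaussianReal_conv_gaussianReal 0 0 (.mk (a ^ 2) (sq_nonneg a) * s)
      (.mk (b ^ 2) (sq_nonneg b) * r)
    rw [← h2, ← h2, Measure.conv, Measure.map_prod_map _ _ (by fun_prop) (by fun_prop),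
      Measure.map_map (by fun_prop) (by fun_prop), add_zero] at h3
    have hu : u = .mk (a ^ 2) (sq_nonneg a) * s + .mk (b ^ 2) (sq_nonneg b) * r := by
      ext; exact h
    rw [hu, ← h3]
    rfl
  have h4 : MeasurePreserving (fun x i => (fun q : ℝ × ℝ => a * q.1 + b * q.2) (x i))
      (Measure.pi fun _ : Fin n => (gaussianReal 0 s).prod (gaussianReal 0 r))
      (gaussVec n u) :=
    measurePreserving_pi (μ := fun _ : Fin n => (gaussianReal 0 s).prod (gaussianReal 0 r))
      (fun _ => gaussianReal 0 u) (f := fun _ q => a * q.1 + b * q.2)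
      fun _ => ⟨by fun_prop, h1⟩
  exact h4.comp (measurePreserving_arrowProdEquivProdArrow ℝ ℝ (Fin n)
    (fun _ => gaussianReal 0 s) (fun _ => gaussianReal 0 r)).symm

lemma integrable_sq_add_gaussVec {n : ℕ} (s : ℝ≥0) (c : Fin n → ℝ) :
    Integrable (fun z => ∑ t, (c t + z t) ^ 2) (gaussVec n s) := by
  refine integrable_finsetSum _ fun t _ => ?_
  have : Integrable (fun x : ℝ => (c t + x) ^ 2) (gaussianReal 0 s) :=
    ((memLp_const (c t)).add (memLp_id_gaussianReal 2)).integrable_sq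
  exact integrable_comp_eval (μ := fun _ : Fin n => gaussianReal 0 s) (i := t) this

lemma integral_sq_add_gaussVec {n : ℕ} (s : ℝ≥0) (c : Fin n → ℝ) :
    ∫ z, ∑ t, (c t + z t) ^ 2 ∂gaussVec n s = ∑ t, c t ^ 2 + n * s := by
  have hI : ∀ c : ℝ, Integrable (fun x : ℝ => (c + x) ^ 2) (gaussianReal 0 s) := fun c =>
    ((memLp_const c).add (memLp_id_gaussianReal 2)).integrable_sq
  have h1 : ∀ c : ℝ, ∫ x, (c + x) ^ 2 ∂gaussianReal 0 s = c ^ 2 + s := by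
    intro c
    have hv := variance_fun_id_gaussianReal (μ := 0) (v := s)
    rw [variance_of_integral_eq_zero (by fun_prop) (by simp)] at hv
    have i1 : Integrable (fun x : ℝ => x) (gaussianReal 0 s) :=
      (memLp_id_gaussianReal 1).integrable le_rfl
    have i2 : Integrable (fun x : ℝ => x ^ 2) (gaussianReal 0 s) := by simpa using hI 0
    have : ∀ x : ℝ, (c + x) ^ 2 = (c ^ 2 + 2 * c * x) + x ^ 2 := fun x => by ring
    simp_rw [this]
    have i3 : Integrable (fun x : ℝ => c ^ 2 + 2 * c * x) (gaussianReal 0 s) :=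
      (integrable_const _).add (i1.const_mul _)
    rw [integral_add i3 i2, integral_add (integrable_const _) (i1.const_mul _),
      integral_const_mul, hv, integral_id_gaussianReal]
    simp
  have hJ : ∀ t ∈ Finset.univ, Integrable (fun z : Fin n → ℝ => (c t + z t) ^ 2)
      (gaussVec n s) := fun t _ =>
    integrable_comp_eval (μ := fun _ : Fin n => gaussianReal 0 s) (i := t) (hI (c t))
  rw [integral_finsetSum _ hJ]
  have : ∀ t, ∫ z, (c t + z t) ^ 2 ∂gaussVec n s = c t ^ 2 + s := by
    intro t
    rw [← h1 (c t)]
    exact integral_comp_eval (μ := fun _ : Fin n => gaussianReal 0 s) (i := t)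
      (f := fun x => (c t + x) ^ 2) (hI (c t)).aestronglyMeasurable
  simp_rw [this, Finset.sum_add_distrib]
  simp

lemma log_gaussVecPDF {n : ℕ} {s : ℝ≥0} (hs : s ≠ 0) (x : Fin n → ℝ) :
    Real.log (gaussVecPDF s x) =
      -(n / 2 * Real.log (2 * Real.pi * s)) - (∑ t, x t ^ 2) / (2 * s) := by
  have hs' : (0 : ℝ) < s := by positivity
  unfold gaussVecPDF
  rw [Real.log_prod fun t _ => (gaussianPDFReal_pos 0 s (x t) hs).ne']
  have : ∀ y : ℝ, Real.log (gaussianPDFReal 0 s y) =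
      -(1 / 2 * Real.log (2 * Real.pi * s)) - y ^ 2 / (2 * s) := by
    intro y
    rw [gaussianPDFReal_def]
    dsimp only
    rw [Real.log_mul (by positivity) (by positivity), Real.log_inv, Real.log_exp,
      Real.log_sqrt (by positivity)]
    ring
  simp_rw [this, Finset.sum_sub_distrib, Finset.sum_div]
  simp; ring

/-- The differential entropy of `gaussVec n s`. -/
def gaussEntropy (n : ℕ) (s : ℝ) : ℝ := n / 2 * Real.log (2 * Real.pi * s) + n / 2

lemma integrable_log_gaussVecPDF {n : ℕ} {s : ℝ≥0} (hs : s ≠ 0) (r : ℝ≥0) (a : Fin n → ℝ) :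
    Integrable (fun z => Real.log (gaussVecPDF s (a + z))) (gaussVec n r) := by
  simp_rw [log_gaussVecPDF hs]
  exact (integrable_const _).sub ((integrable_sq_add_gaussVec r a).div_const _)

lemma integral_log_gaussVecPDF_add {n : ℕ} {s : ℝ≥0} (hs : s ≠ 0) (r : ℝ≥0) (a : Fin n → ℝ) :
    ∫ z, Real.log (gaussVecPDF s (a + z)) ∂gaussVec n r =
      -(n / 2 * Real.log (2 * Real.pi * s)) - (∑ t, a t ^ 2 + n * r) / (2 * s) := by
  simp_rw [log_gaussVecPDF hs, Pi.add_apply]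
  rw [integral_sub (integrable_const _) ((integrable_sq_add_gaussVec r a).div_const _),
    integral_div]
  simp [integral_sq_add_gaussVec]

lemma integral_log_gaussVecPDF {n : ℕ} {s : ℝ≥0} (hs : s ≠ 0) :
    ∫ z, Real.log (gaussVecPDF s z) ∂gaussVec n s = -gaussEntropy n s := by
  have h := integral_log_gaussVecPDF_add hs s (0 : Fin n → ℝ)
  have hs' : (s : ℝ) ≠ 0 := by exact_mod_cast hs
  simp only [zero_add] at h
  rw [h, gaussEntropy]
  simp
  field_simp
  ring

lemma lintegral_gaussVecPDF (n : ℕ) {s : ℝ≥0} (hs : s ≠ 0) :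
    ∫⁻ x : Fin n → ℝ, ENNReal.ofReal (gaussVecPDF s x) = 1 := by
  have h := measure_univ (μ := gaussVec n s)
  rwa [gaussVec_eq_withDensity n hs, withDensity_apply _ MeasurableSet.univ,
    setLIntegral_univ] at h

/-- Triangular with unit diagonal, hence no Jacobian. All changes of output coordinates, such as
replacing Y₁ by Y₁ − S/g, are compositions of these maps with swaps. -/
lemma measurePreserving_shear {n : ℕ} (a b : Fin n → ℝ) (α : ℝ) :
    MeasurePreserving (fun p : (Fin n → ℝ) × (Fin n → ℝ) => (a + p.1, b + (p.2 + α • p.1)))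
      (volume.prod volume) (volume.prod volume) := by
  refine (measurePreserving_add_left volume a).skew_product
    (g := fun x y => b + (y + α • x)) (by fun_prop) (Eventually.of_forall fun x => ?_)
  exact ((measurePreserving_add_left volume b).comp
    (measurePreserving_add_right volume (α • x))).map_eq

/-! ### Gibbs' inequality and a Fano inequality -/

/-- Gibbs' inequality, for an unnormalized comparison density `f` of total mass at most `c`. -/
lemma integral_log_sub_le {Ω : Type*} [MeasurableSpace Ω] {ν Γ : Measure Ω}
    [IsProbabilityMeasure Γ] {p f : Ω → ℝ} (hΓ : Γ = ν.withDensity fun x => ENNReal.ofReal (p x))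
    (hp : ∀ x, 0 < p x) (hpm : Measurable p) (hf : ∀ x, 0 < f x) (hfm : Measurable f) {c : ℝ}
    (hc : 0 ≤ c) (hfc : ∫⁻ x, ENNReal.ofReal (f x) ∂ν ≤ ENNReal.ofReal c)
    (hpi : Integrable (fun x => Real.log (p x)) Γ) (hfi : Integrable (fun x => Real.log (f x)) Γ) :
    ∫ x, Real.log (f x) ∂Γ - ∫ x, Real.log (p x) ∂Γ ≤ c - 1 := by
  have hlin : ∫⁻ x, ENNReal.ofReal (f x / p x) ∂Γ = ∫⁻ x, ENNReal.ofReal (f x) ∂ν := by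
    rw [hΓ, lintegral_withDensity_eq_lintegral_mul _ (by fun_prop) (by fun_prop)]
    refine lintegral_congr fun x => ?_
    rw [Pi.mul_apply, ← ENNReal.ofReal_mul (hp x).le, mul_div_cancel₀ _ (hp x).ne']
  have hnn : ∀ x, 0 ≤ f x / p x := fun x => (div_pos (hf x) (hp x)).le
  have hint : Integrable (fun x => f x / p x) Γ := by
    refine ⟨(hfm.div hpm).aestronglyMeasurable, ?_⟩
    rw [hasFiniteIntegral_iff_ofReal (Eventually.of_forall hnn), hlin]
    exact hfc.trans_lt ENNReal.ofReal_lt_top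
  have hle : ∫ x, f x / p x ∂Γ ≤ c := by
    rw [integral_eq_lintegral_of_nonneg_ae (Eventually.of_forall hnn) hint.aestronglyMeasurable,
      hlin]
    exact ENNReal.toReal_le_of_le_ofReal hc hfc
  rw [← integral_sub hfi hpi]
  calc ∫ x, (Real.log (f x) - Real.log (p x)) ∂Γ ≤ ∫ x, (f x / p x - 1) ∂Γ := by
        refine integral_mono (hfi.sub hpi) (hint.sub (integrable_const _)) fun x => ?_
        rw [← Real.log_div (hf x).ne' (hp x).ne']
        exact Real.log_le_sub_one_of_pos (div_pos (hf x) (hp x))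
    _ = ∫ x, f x / p x ∂Γ - 1 := by
        rw [integral_sub hint (integrable_const _)]; simp
    _ ≤ c - 1 := by linarith

/-- A Fano inequality: if `τ m` carries the noise law `Γ` (of density `p`) to the law of the
observation given message `m`, then the success probability of the decoder with decision regions
`D m` is bounded by the relative entropies to any fixed output density `q`. -/
lemma fano_inequality {Ω ι : Type*} [MeasurableSpace Ω] [Fintype ι] [Nonempty ι]
    {ν Γ : Measure Ω} [IsProbabilityMeasure Γ] {p q : Ω → ℝ}
    (hΓ : Γ = ν.withDensity fun x => ENNReal.ofReal (p x))
    (hp : ∀ x, 0 < p x) (hpm : Measurable p) (hq : ∀ x, 0 < q x) (hqm : Measurable q)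
    (hq1 : ∫⁻ x, ENNReal.ofReal (q x) ∂ν ≤ 1) {τ : ι → Ω → Ω}
    (hτ : ∀ m, MeasurePreserving (τ m) ν ν) {D : ι → Set Ω} (hD : ∀ m, MeasurableSet (D m))
    (hdisj : Pairwise (Function.onFun Disjoint D))
    (hpi : Integrable (fun x => Real.log (p x)) Γ)
    (hqi : ∀ m, Integrable (fun x => Real.log (q (τ m x))) Γ) :
    Real.log (Fintype.card ι) * ∑ m, Γ.real (τ m ⁻¹' D m) ≤
      ∑ m, (∫ x, Real.log (p x) ∂Γ - ∫ x, Real.log (q (τ m x)) ∂Γ) + Fintype.card ι := by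
  classical
  set M : ℝ := (Fintype.card ι : ℝ) with hM
  have hM0 : 0 < M := by simp [hM, Fintype.card_pos]
  set d : ι → ℝ := fun m => (∫⁻ x in D m, ENNReal.ofReal (q x) ∂ν).toReal with hd
  have hsum : ∑ m, ∫⁻ x in D m, ENNReal.ofReal (q x) ∂ν ≤ 1 := by
    rw [← tsum_fintype (L := .unconditional _), ← lintegral_iUnion hD hdisj]
    exact (setLIntegral_le_lintegral _ _).trans hq1
  have hfin : ∀ m, ∫⁻ x in D m, ENNReal.ofReal (q x) ∂ν ≠ ∞ := fun m =>
    ne_top_of_le_ne_top ENNReal.one_ne_top ((setLIntegral_le_lintegral _ _).trans hq1)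
  have hd1 : ∑ m, d m ≤ 1 := by
    rw [hd, ← ENNReal.toReal_sum fun m _ => hfin m]
    exact ENNReal.toReal_le_of_le_ofReal zero_le_one (by simpa using hsum)
  have hd0 : ∀ m, 0 ≤ d m := fun m => ENNReal.toReal_nonneg
  have key : ∀ m, Real.log M * Γ.real (τ m ⁻¹' D m) + ∫ x, Real.log (q (τ m x)) ∂Γ -
      ∫ x, Real.log (p x) ∂Γ ≤ M * d m := by
    intro m
    -- Tilting `q` by the factor `M` on the decision region puts log `M` times the success
    -- probability on the left of Gibbs' inequality, while the mass of the comparison density only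
    -- grows to at most 1 + `M * d m`.
    set w : Ω → ℝ := fun y => if y ∈ D m then M else 1 with hw
    have hw0 : ∀ y, 0 < w y := fun y => by by_cases h : y ∈ D m <;> simp [hw, h, hM0]
    have hwm : Measurable w := Measurable.ite (hD m) measurable_const measurable_const
    have hlog : ∀ x, Real.log (q (τ m x) * w (τ m x)) = Real.log (q (τ m x)) +
        (τ m ⁻¹' D m).indicator (fun _ => Real.log M) x := by
      intro x
      rw [Real.log_mul (hq _).ne' (hw0 _).ne']
      by_cases h : τ m x ∈ D m <;> simp [hw, h]
    have hind : Integrable ((τ m ⁻¹' D m).indicator fun _ => Real.log M) Γ :=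
      (integrable_const _).indicator ((hτ m).measurable (hD m))
    have hmass : ∫⁻ x, ENNReal.ofReal (q (τ m x) * w (τ m x)) ∂ν ≤
        ENNReal.ofReal (1 + M * d m) := by
      rw [(hτ m).lintegral_comp (f := fun y => ENNReal.ofReal (q y * w y)) (by fun_prop)]
      have : ∀ y, ENNReal.ofReal (q y * w y) ≤ ENNReal.ofReal (q y) +
          (D m).indicator (fun y => ENNReal.ofReal M * ENNReal.ofReal (q y)) y := by
        intro y
        by_cases h : y ∈ D m
        · rw [Set.indicator_of_mem h, ← ENNReal.ofReal_mul hM0.le]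
          simp [hw, h, mul_comm M]
        · simp [hw, h]
      refine (lintegral_mono this).trans ?_
      rw [lintegral_add_left (by fun_prop), lintegral_indicator (hD m),
        lintegral_const_mul _ (by fun_prop), ENNReal.ofReal_add zero_le_one
        (mul_nonneg hM0.le (hd0 m)), ENNReal.ofReal_mul hM0.le, hd, ENNReal.ofReal_toReal (hfin m)]
      gcongr
      simpa using hq1
    have hqw : Integrable (fun x => Real.log (q (τ m x) * w (τ m x))) Γ := by
      simp_rw [hlog]; exact (hqi m).add hind
    have hτm := (hτ m).measurable
    have := integral_log_sub_le hΓ hp hpm (f := fun x => q (τ m x) * w (τ m x))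
      (fun x => mul_pos (hq _) (hw0 _)) ((hqm.comp hτm).mul (hwm.comp hτm))
      (c := 1 + M * d m) (by have := hd0 m; positivity) hmass hpi hqw
    simp_rw [hlog] at this
    rw [integral_add (hqi m) hind, integral_indicator ((hτ m).measurable (hD m))] at this
    simp only [integral_const, smul_eq_mul, measureReal_restrict_apply_univ] at this
    linarith [mul_comm (Γ.real (τ m ⁻¹' D m)) (Real.log M)]
  have h1 := Finset.sum_le_sum fun m (_ : m ∈ Finset.univ) => key m
  rw [← Finset.mul_sum, Finset.sum_sub_distrib, Finset.sum_add_distrib, ← Finset.mul_sum] at h1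
  rw [Finset.sum_sub_distrib]
  -- Disjoint decision regions have total `q`-mass at most 1, so the tilts cost one nat per message
  -- on average.
  have : M * ∑ m, d m ≤ M := by nlinarith
  linarith

/-! ### Gaussian mixtures and their entropy -/

/-- The density of a uniform mixture of Gaussian vectors with means `μ i`. -/
def mixPDF {ι : Type*} [Fintype ι] {n : ℕ} (μ : ι → Fin n → ℝ) (s : ℝ≥0) (x : Fin n → ℝ) : ℝ :=
  (∑ i, gaussVecPDF s (x - μ i)) / Fintype.card ι

/-- A uniform mixture of Gaussian vectors with means `μ i`. -/
def mixMeasure {ι : Type*} [Fintype ι] {n : ℕ} (μ : ι → Fin n → ℝ) (s : ℝ≥0) :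
    Measure (Fin n → ℝ) :=
  volume.withDensity fun x => ENNReal.ofReal (mixPDF μ s x)

/-- The differential entropy of a uniform mixture of Gaussian vectors. -/
def mixEntropy {ι : Type*} [Fintype ι] {n : ℕ} (μ : ι → Fin n → ℝ) (s : ℝ≥0) : ℝ :=
  -∫ x, Real.log (mixPDF μ s x) ∂mixMeasure μ s

lemma integral_comp_measurePreserving {α β : Type*} [MeasurableSpace α] [MeasurableSpace β]
    {μ : Measure α} {ν : Measure β} {φ : α → β} (hφ : MeasurePreserving φ μ ν) {F : β → ℝ}
    (hF : Measurable F) : ∫ x, F (φ x) ∂μ = ∫ y, F y ∂ν := by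
  rw [← hφ.map_eq, integral_map hφ.aemeasurable hF.aestronglyMeasurable]

lemma lintegral_ofReal_mul_eq_one {α β : Type*} [MeasurableSpace α] [MeasurableSpace β]
    {μ : Measure α} {ν : Measure β} [SFinite ν] {f : α → ℝ} {g : β → ℝ} (hf : Measurable f)
    (hf0 : ∀ x, 0 < f x) (hg : Measurable g) (hf1 : ∫⁻ x, ENNReal.ofReal (f x) ∂μ = 1)
    (hg1 : ∫⁻ x, ENNReal.ofReal (g x) ∂ν = 1) :
    ∫⁻ x, ENNReal.ofReal (f x.1 * g x.2) ∂(μ.prod ν) = 1 := by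
  simp_rw [ENNReal.ofReal_mul (hf0 _).le]
  rw [lintegral_prod_mul (f := fun x => ENNReal.ofReal (f x)) (g := fun x => ENNReal.ofReal (g x))
    (by fun_prop) (by fun_prop), hf1, hg1, one_mul]

lemma prod_withDensity_ofReal {α β : Type*} [MeasurableSpace α] [MeasurableSpace β]
    {μ : Measure α} {ν : Measure β} [SFinite μ] [SFinite ν] {f : α → ℝ} {g : β → ℝ}
    (hf : Measurable f) (hf0 : ∀ x, 0 < f x) (hg : Measurable g) :
    (μ.withDensity fun x => ENNReal.ofReal (f x)).prod
      (ν.withDensity fun x => ENNReal.ofReal (g x)) =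
      (μ.prod ν).withDensity fun x => ENNReal.ofReal (f x.1 * g x.2) := by
  rw [prod_withDensity (by fun_prop) (by fun_prop)]
  simp_rw [ENNReal.ofReal_mul (hf0 _).le]

section mix

variable {ι : Type*} [Fintype ι] [Nonempty ι] {n : ℕ} (μ : ι → Fin n → ℝ) {s : ℝ≥0}

@[fun_prop]
lemma measurable_mixPDF {ι : Type*} [Fintype ι] {n : ℕ} (μ : ι → Fin n → ℝ) (s : ℝ≥0) :
    Measurable (mixPDF μ s) := by
  unfold mixPDF
  refine Measurable.div_const (Finset.measurable_sum _ fun i _ => ?_) _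
  fun_prop

lemma mixPDF_pos (hs : s ≠ 0) (x : Fin n → ℝ) : 0 < mixPDF μ s x :=
  div_pos (Finset.sum_pos (fun _ _ => gaussVecPDF_pos hs _) Finset.univ_nonempty)
    (by simp [Fintype.card_pos])

lemma mixMeasure_eq (hs : s ≠ 0) : mixMeasure μ s =
    (Fintype.card ι : ℝ≥0∞)⁻¹ • ∑ i, (gaussVec n s).map (μ i + ·) := by
  ext S hS
  have hc : (0 : ℝ) < Fintype.card ι := by simp [Fintype.card_pos]
  have h1 : ∀ i, (gaussVec n s).map (μ i + ·) S =
      ∫⁻ x in S, ENNReal.ofReal (gaussVecPDF s (x - μ i)) := by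
    intro i
    rw [Measure.map_apply (by fun_prop) hS, gaussVec_eq_withDensity n hs,
      withDensity_apply _ ((measurable_const_add _) hS),
      ← (measurePreserving_add_left volume (μ i)).setLIntegral_comp_preimage hS
        (f := fun x => ENNReal.ofReal (gaussVecPDF s (x - μ i))) (by fun_prop)]
    simp
  rw [mixMeasure, withDensity_apply _ hS, Measure.smul_apply, Measure.finsetSum_apply]
  simp_rw [h1]
  rw [← lintegral_finsetSum _ fun i _ => by fun_prop, smul_eq_mul,
    ← lintegral_const_mul _ (by fun_prop)]
  refine lintegral_congr fun x => ?_
  rw [mixPDF, div_eq_inv_mul, ENNReal.ofReal_mul (by positivity), ENNReal.ofReal_inv_of_pos hc,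
    ENNReal.ofReal_natCast, ENNReal.ofReal_sum_of_nonneg fun i _ => (gaussVecPDF_pos hs _).le]

lemma isProbabilityMeasure_mixMeasure (hs : s ≠ 0) : IsProbabilityMeasure (mixMeasure μ s) := by
  refine ⟨?_⟩
  have : ∀ i, (gaussVec n s).map (μ i + ·) Set.univ = 1 := fun i => by
    rw [Measure.map_apply (by fun_prop) MeasurableSet.univ]; simp
  rw [mixMeasure_eq μ hs, Measure.smul_apply, Measure.finsetSum_apply]
  simp only [this, Finset.sum_const, Finset.card_univ, nsmul_eq_mul, mul_one, smul_eq_mul]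
  exact ENNReal.inv_mul_cancel (by simp) (by simp)

lemma lintegral_mixPDF (hs : s ≠ 0) : ∫⁻ x, ENNReal.ofReal (mixPDF μ s x) = 1 := by
  have := isProbabilityMeasure_mixMeasure μ hs
  have h := measure_univ (μ := mixMeasure μ s)
  rwa [mixMeasure, withDensity_apply _ MeasurableSet.univ, setLIntegral_univ] at h

lemma integrable_mixMeasure (hs : s ≠ 0) {f : (Fin n → ℝ) → ℝ} (hfm : Measurable f)
    (hf : ∀ i, Integrable (fun z => f (μ i + z)) (gaussVec n s)) :
    Integrable f (mixMeasure μ s) := by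
  rw [mixMeasure_eq μ hs]
  refine Integrable.smul_measure ?_ (by simp)
  rw [integrable_finsetSum_measure]
  intro i _
  rw [integrable_map_measure hfm.aestronglyMeasurable (by fun_prop)]
  exact hf i

lemma integral_mixMeasure (hs : s ≠ 0) {f : (Fin n → ℝ) → ℝ} (hfm : Measurable f)
    (hf : ∀ i, Integrable (fun z => f (μ i + z)) (gaussVec n s)) :
    ∫ x, f x ∂mixMeasure μ s = (∑ i, ∫ z, f (μ i + z) ∂gaussVec n s) / Fintype.card ι := by
  rw [mixMeasure_eq μ hs, integral_smul_measure, integral_finsetSum_measure]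
  · have : ∀ i, ∫ x, f x ∂(gaussVec n s).map (μ i + ·) = ∫ z, f (μ i + z) ∂gaussVec n s :=
      fun i => integral_map (by fun_prop) hfm.aestronglyMeasurable
    simp_rw [this]
    simp [div_eq_inv_mul]
  · intro i _
    rw [integrable_map_measure hfm.aestronglyMeasurable (by fun_prop)]
    exact hf i

lemma measureReal_mixMeasure (hs : s ≠ 0) {S : Set (Fin n → ℝ)} (hS : MeasurableSet S) :
    (mixMeasure μ s).real S =
      (∑ i, (gaussVec n s).real {z | μ i + z ∈ S}) / Fintype.card ι := by
  have hS' : ∀ i, MeasurableSet {z | μ i + z ∈ S} := fun i => measurable_const_add (μ i) hS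
  have e : ∀ i z, S.indicator (1 : (Fin n → ℝ) → ℝ) (μ i + z) =
      {z | μ i + z ∈ S}.indicator 1 z := fun i z => by simp [Set.indicator]
  rw [← integral_indicator_one hS, integral_mixMeasure μ hs (measurable_one.indicator hS)]
  · simp_rw [e, integral_indicator_one (hS' _)]
  · intro i
    simp_rw [e]
    exact (integrable_const (1 : ℝ)).indicator (hS' i)

lemma gaussVecPDF_le (hs : s ≠ 0) (x : Fin n → ℝ) :
    gaussVecPDF s x ≤ gaussVecPDF s (0 : Fin n → ℝ) := by
  rw [← Real.log_le_log_iff (gaussVecPDF_pos hs _) (gaussVecPDF_pos hs _), log_gaussVecPDF hs,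
    log_gaussVecPDF hs]
  have : 0 ≤ (∑ t, x t ^ 2) / (2 * (s : ℝ)) := by positivity
  simpa using this

/-- The mixture lies between a single component divided by the number of components and the peak of
the Gaussian density. Hence its logarithm grows at most quadratically, which is all that
integrability against Gaussian laws needs. -/
lemma abs_log_mixPDF_le (hs : s ≠ 0) (j : ι) : ∃ C : ℝ, ∀ x,
    |Real.log (mixPDF μ s x)| ≤ C + (∑ t, (x t - μ j t) ^ 2) / (2 * s) := by
  set L := Real.log (gaussVecPDF s (0 : Fin n → ℝ)) with hL
  have hc : (1 : ℝ) ≤ Fintype.card ι := by exact_mod_cast Fintype.card_pos (α := ι)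
  refine ⟨|L| + Real.log (Fintype.card ι), fun x => ?_⟩
  have hlc : 0 ≤ Real.log (Fintype.card ι) := Real.log_nonneg hc
  have h2 : 0 ≤ (∑ t, (x t - μ j t) ^ 2) / (2 * (s : ℝ)) := by positivity
  rw [abs_le]
  constructor
  · have h3 : gaussVecPDF s (x - μ j) / Fintype.card ι ≤ mixPDF μ s x := by
      unfold mixPDF
      gcongr
      exact Finset.single_le_sum (f := fun i => gaussVecPDF s (x - μ i))
        (fun i _ => (gaussVecPDF_pos hs _).le) (Finset.mem_univ j)
    have h4 := Real.log_le_log (div_pos (gaussVecPDF_pos hs _) (by linarith)) h3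
    rw [Real.log_div (gaussVecPDF_pos hs _).ne' (by linarith), log_gaussVecPDF hs] at h4
    rw [log_gaussVecPDF hs] at hL
    simp only [Pi.sub_apply] at h4
    have h5 : L = -(n / 2 * Real.log (2 * Real.pi * s)) := by simpa using hL
    have := neg_abs_le L
    linarith
  · have h3 : mixPDF μ s x ≤ gaussVecPDF s (0 : Fin n → ℝ) := by
      unfold mixPDF
      rw [div_le_iff₀ (by linarith)]
      calc ∑ i, gaussVecPDF s (x - μ i) ≤ ∑ i : ι, gaussVecPDF s (0 : Fin n → ℝ) :=
            Finset.sum_le_sum fun i _ => gaussVecPDF_le hs _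
        _ = _ := by simp [mul_comm]
    have h4 := Real.log_le_log (mixPDF_pos μ hs x) h3
    have := le_abs_self L
    linarith

lemma integrable_log_mixPDF (hs : s ≠ 0) (r : ℝ≥0) (a : Fin n → ℝ) :
    Integrable (fun z => Real.log (mixPDF μ s (a + z))) (gaussVec n r) := by
  obtain ⟨j⟩ := ‹Nonempty ι›
  have : Nonempty ι := ⟨j⟩
  obtain ⟨C, hC⟩ := abs_log_mixPDF_le μ hs j
  have hg : Integrable (fun z => C + (∑ t, ((a - μ j) t + z t) ^ 2) / (2 * (s : ℝ)))
      (gaussVec n r) :=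
    (integrable_const C).add ((integrable_sq_add_gaussVec r (a - μ j)).div_const _)
  refine hg.mono' (Measurable.aestronglyMeasurable (by fun_prop)) (Eventually.of_forall fun z => ?_)
  rw [Real.norm_eq_abs]
  refine (hC _).trans_eq ?_
  congr 2
  refine Finset.sum_congr rfl fun t _ => ?_
  simp only [Pi.add_apply, Pi.sub_apply]
  ring

lemma integrable_log_mixPDF_mixMeasure {κ : Type*} [Fintype κ] [Nonempty κ] (ν : κ → Fin n → ℝ)
    (hs : s ≠ 0) {r : ℝ≥0} (hr : r ≠ 0) :
    Integrable (fun x => Real.log (mixPDF μ s x)) (mixMeasure ν r) :=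
  integrable_mixMeasure ν hr (by fun_prop) fun i => integrable_log_mixPDF μ hs r (ν i)

lemma integral_log_mixPDF (hs : s ≠ 0) :
    ∑ i, ∫ z, Real.log (mixPDF μ s (μ i + z)) ∂gaussVec n s =
      -(Fintype.card ι * mixEntropy μ s) := by
  have hc : (Fintype.card ι : ℝ) ≠ 0 := by simp
  rw [mixEntropy, integral_mixMeasure μ hs (by fun_prop) fun i => integrable_log_mixPDF μ hs s _]
  field_simp

/-- Adding an independent Gaussian vector to a Gaussian mixture. -/
lemma measurePreserving_linearComb_mixMeasure {s r u : ℝ≥0} (hs : s ≠ 0) (hu : u ≠ 0) {a b : ℝ}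
    (h : (u : ℝ) = a ^ 2 * s + b ^ 2 * r) :
    MeasurePreserving (fun p : (Fin n → ℝ) × (Fin n → ℝ) => a • p.1 + b • p.2)
      ((mixMeasure μ s).prod (gaussVec n r)) (mixMeasure (fun i => a • μ i) u) := by
  refine ⟨by fun_prop, ?_⟩
  ext S hS
  have hm : Measurable fun p : (Fin n → ℝ) × (Fin n → ℝ) => a • p.1 + b • p.2 := by fun_prop
  rw [Measure.map_apply hm hS, Measure.prod_apply (hm hS), mixMeasure_eq μ hs, mixMeasure_eq _ hu,
    lintegral_smul_measure, lintegral_finsetSum_measure, Measure.smul_apply,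
    Measure.finsetSum_apply]
  congr 1
  refine Finset.sum_congr rfl fun i _ => ?_
  have hS' : MeasurableSet ((a • μ i + ·) ⁻¹' S) := (measurable_const_add _) hS
  rw [lintegral_map (measurable_measure_prodMk_left (hm hS)) (by fun_prop),
    Measure.map_apply (by fun_prop) hS,
    ← (measurePreserving_linearComb_gaussVec n h).measure_preimage hS'.nullMeasurableSet,
    Measure.prod_apply (hm hS')]
  refine lintegral_congr fun x => ?_
  congr 1
  ext y
  simp [add_assoc]

lemma measurePreserving_add_smul_mixMeasure {s r u : ℝ≥0} (hs : s ≠ 0) (hu : u ≠ 0) {b : ℝ}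
    (h : (u : ℝ) = s + b ^ 2 * r) :
    MeasurePreserving (fun p : (Fin n → ℝ) × (Fin n → ℝ) => p.1 + b • p.2)
      ((mixMeasure μ s).prod (gaussVec n r)) (mixMeasure μ u) := by
  simpa using measurePreserving_linearComb_mixMeasure μ hs hu (a := 1) (b := b) (r := r)
    (by simpa using h)

/-! ### Gaussian noise as the worst additive noise -/

/-- The map (x₁, x₂) ↦ (x₁ + x₂, x₁ − k(x₁ + x₂)) is a shear, a swap and a shear, so it preserves
volume and carries the integrand to a product of two probability densities. -/
lemma lintegral_mixPDF_mul_gaussVecPDF (hs : s ≠ 0) {ρ : ℝ≥0} (hρ : ρ ≠ 0) (k : ℝ) :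
    ∫⁻ x : (Fin n → ℝ) × (Fin n → ℝ), ENNReal.ofReal
      (mixPDF μ s (x.1 + (1 : ℝ) • x.2) * gaussVecPDF ρ ((1 - k) • x.1 + (-k) • x.2))
      ∂(volume.prod volume) = 1 := by
  have t := (measurePreserving_shear (0 : Fin n → ℝ) 0 (-k)).comp
    (Measure.measurePreserving_swap.comp (measurePreserving_shear (0 : Fin n → ℝ) 0 1))
  rw [← lintegral_ofReal_mul_eq_one (measurable_mixPDF μ s) (mixPDF_pos μ hs)
    (measurable_gaussVecPDF ρ) (lintegral_mixPDF μ hs) (lintegral_gaussVecPDF n hρ),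
    ← t.lintegral_comp (f := fun x => ENNReal.ofReal (mixPDF μ s x.1 * gaussVecPDF ρ x.2))
      (by fun_prop)]
  refine lintegral_congr fun x => ?_
  simp only [Function.comp_apply, zero_add, Prod.swap, one_smul]
  congr 3
  · rw [add_comm]
  · module

lemma integral_log_gaussVecPDF_mixMeasure (hs : s ≠ 0) {ρ : ℝ≥0} (hρ : ρ ≠ 0) :
    ∫ x, Real.log (gaussVecPDF ρ x) ∂mixMeasure μ s = -(n / 2 * Real.log (2 * Real.pi * ρ)) -
      ((∑ i, ∑ t, μ i t ^ 2) / Fintype.card ι + n * s) / (2 * ρ) := by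
  have hc : (Fintype.card ι : ℝ) ≠ 0 := by simp
  have hρ' : (ρ : ℝ) ≠ 0 := by exact_mod_cast hρ
  rw [integral_mixMeasure μ hs (by fun_prop) fun i => integrable_log_gaussVecPDF hρ s _]
  simp_rw [integral_log_gaussVecPDF_add hρ]
  rw [Finset.sum_sub_distrib, ← Finset.sum_div, Finset.sum_add_distrib]
  simp only [Finset.sum_const, Finset.card_univ, nsmul_eq_mul]
  field_simp

lemma integrable_log_gaussVecPDF_mixMeasure (hs : s ≠ 0) {ρ : ℝ≥0} (hρ : ρ ≠ 0) :
    Integrable (fun x => Real.log (gaussVecPDF ρ x)) (mixMeasure μ s) :=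
  integrable_mixMeasure _ hs (by fun_prop) fun i => integrable_log_gaussVecPDF hρ s _

/-- For a mixture X and independent Gaussian noise N, this bounds h(X) + h(N) = h(X, N) by passing
to the coordinates X + N and X − k(X + N), the error of a linear estimate of X. Gibbs' inequality
compares the joint law with the true density of the sum times a Gaussian density of variance `ρ` for
the error. -/
lemma mixEntropy_sub_le_aux (hs : s ≠ 0) {r ρ u : ℝ≥0} {k : ℝ} (hr : r ≠ 0) (hρ : ρ ≠ 0)
    (hu : u ≠ 0) (hsr : (1 : ℝ) = s + r) (huk : (u : ℝ) = (1 - k) ^ 2 * s + (-k) ^ 2 * r) :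
    ∫ x, Real.log (gaussVecPDF ρ x) ∂mixMeasure (fun i => (1 - k) • μ i) u - mixEntropy μ 1 ≤
      -mixEntropy μ s - gaussEntropy n r := by
  have := isProbabilityMeasure_mixMeasure μ hs
  have hΓ : (mixMeasure μ s).prod (gaussVec n r) = (volume.prod volume).withDensity
      fun x => ENNReal.ofReal (mixPDF μ s x.1 * gaussVecPDF r x.2) := by
    rw [mixMeasure, gaussVec_eq_withDensity n hr, prod_withDensity_ofReal (by fun_prop)
      (mixPDF_pos μ hs) (by fun_prop)]
  have hlogp : ∀ x : (Fin n → ℝ) × (Fin n → ℝ),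
      Real.log (mixPDF μ s x.1 * gaussVecPDF r x.2) =
        Real.log (mixPDF μ s x.1) + Real.log (gaussVecPDF r x.2) := fun x =>
    Real.log_mul (mixPDF_pos μ hs _).ne' (gaussVecPDF_pos hr _).ne'
  have hlogf : ∀ x : (Fin n → ℝ) × (Fin n → ℝ),
      Real.log (mixPDF μ 1 (x.1 + (1 : ℝ) • x.2) * gaussVecPDF ρ ((1 - k) • x.1 + (-k) • x.2)) =
        Real.log (mixPDF μ 1 (x.1 + (1 : ℝ) • x.2)) +
          Real.log (gaussVecPDF ρ ((1 - k) • x.1 + (-k) • x.2)) := fun x =>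
    Real.log_mul (mixPDF_pos μ one_ne_zero _).ne' (gaussVecPDF_pos hρ _).ne'
  have i2 : Integrable (fun x => Real.log (gaussVecPDF r x)) (gaussVec n r) := by
    simpa using integrable_log_gaussVecPDF hr r (0 : Fin n → ℝ)
  have m3 : MeasurePreserving (fun p : (Fin n → ℝ) × (Fin n → ℝ) => p.1 + (1 : ℝ) • p.2)
      ((mixMeasure μ s).prod (gaussVec n r)) (mixMeasure μ 1) :=
    measurePreserving_add_smul_mixMeasure μ hs one_ne_zero (by rw [NNReal.coe_one]; linarith)
  have m4 := measurePreserving_linearComb_mixMeasure μ hs hu huk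
  have j1 : Integrable (fun x : (Fin n → ℝ) × (Fin n → ℝ) => Real.log (mixPDF μ s x.1))
      ((mixMeasure μ s).prod (gaussVec n r)) :=
    (integrable_log_mixPDF_mixMeasure μ μ hs hs).comp_fst _
  have j2 : Integrable (fun x : (Fin n → ℝ) × (Fin n → ℝ) => Real.log (gaussVecPDF r x.2))
      ((mixMeasure μ s).prod (gaussVec n r)) := i2.comp_snd _
  have j3 : Integrable (fun x : (Fin n → ℝ) × (Fin n → ℝ) =>
      Real.log (mixPDF μ 1 (x.1 + (1 : ℝ) • x.2))) ((mixMeasure μ s).prod (gaussVec n r)) :=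
    m3.integrable_comp_of_integrable
      (integrable_log_mixPDF_mixMeasure μ μ one_ne_zero one_ne_zero)
  have j4 : Integrable (fun x : (Fin n → ℝ) × (Fin n → ℝ) =>
      Real.log (gaussVecPDF ρ ((1 - k) • x.1 + (-k) • x.2)))
      ((mixMeasure μ s).prod (gaussVec n r)) :=
    m4.integrable_comp_of_integrable (integrable_log_gaussVecPDF_mixMeasure _ hu hρ)
  have G := integral_log_sub_le hΓ
    (fun x => mul_pos (mixPDF_pos μ hs _) (gaussVecPDF_pos hr _)) (by fun_prop)
    (f := fun x => mixPDF μ 1 (x.1 + (1 : ℝ) • x.2) *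
      gaussVecPDF ρ ((1 - k) • x.1 + (-k) • x.2))
    (fun x => mul_pos (mixPDF_pos μ one_ne_zero _) (gaussVecPDF_pos hρ _)) (by fun_prop)
    zero_le_one (by rw [lintegral_mixPDF_mul_gaussVecPDF μ one_ne_zero hρ]; simp)
    (by simp_rw [hlogp]; exact j1.add j2) (by simp_rw [hlogf]; exact j3.add j4)
  simp_rw [hlogp, hlogf] at G
  rw [integral_add j1 j2, integral_add j3 j4,
    integral_fun_fst (fun x => Real.log (mixPDF μ s x)),
    integral_fun_snd (fun x => Real.log (gaussVecPDF r x)),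
    integral_comp_measurePreserving m3 (F := fun x => Real.log (mixPDF μ 1 x)) (by fun_prop),
    integral_comp_measurePreserving m4 (F := fun x => Real.log (gaussVecPDF ρ x)) (by fun_prop),
    integral_log_gaussVecPDF hr] at G
  simp only [probReal_univ, one_smul] at G
  simp only [mixEntropy]
  linarith

/-- Gaussian noise is the worst additive noise: among mixtures with mean square norm at most `n Q`,
removing noise changes the entropy by at most the amount for a Gaussian input. -/
lemma mixEntropy_sub_le (hs : s ≠ 0) (hs1 : (s : ℝ) ≤ 1) {Q : ℝ} (hQ : 0 ≤ Q)
    (hμ : ∀ i, ∑ t, μ i t ^ 2 ≤ n * Q) :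
    mixEntropy μ s - mixEntropy μ 1 ≤ n / 2 * Real.log ((Q + s) / (Q + 1)) := by
  have hs0 : (0 : ℝ) < s := by positivity
  -- With `s` = 1 the added noise would have variance 0 and no density; there both sides vanish.
  rcases hs1.eq_or_lt with h1 | h1
  · have : s = 1 := by ext; exact h1
    subst this
    have : Q + 1 ≠ 0 := by positivity
    simp [div_self this]
  obtain ⟨r, hr⟩ : ∃ r : ℝ≥0, (r : ℝ) = 1 - s := ⟨⟨1 - s, by linarith⟩, rfl⟩
  have hr0 : (0 : ℝ) < r := by rw [hr]; linarith
  have hrne : r ≠ 0 := by rintro rfl; simp at hr0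
  -- The Wiener coefficient for estimating a signal of variance `Q + s` from its sum with noise of
  -- variance 1 − `s`. The mean square error is then `ρ` = k(1 − s), so the entropy gap becomes
  -- (n/2) log(ρ/r) = (n/2) log k.
  set k : ℝ := (Q + s) / (Q + 1) with hk
  have hk0 : 0 < k := by positivity
  obtain ⟨ρ, hρ⟩ : ∃ ρ : ℝ≥0, (ρ : ℝ) = k * r := ⟨⟨k * r, by positivity⟩, rfl⟩
  have hρ0 : (0 : ℝ) < ρ := by rw [hρ]; positivity
  have hρne : ρ ≠ 0 := by rintro rfl; simp at hρ0
  obtain ⟨u, hu⟩ : ∃ u : ℝ≥0, (u : ℝ) = (1 - k) ^ 2 * s + (-k) ^ 2 * r :=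
    ⟨⟨(1 - k) ^ 2 * s + (-k) ^ 2 * r, by positivity⟩, rfl⟩
  have hune : u ≠ 0 := by
    have : (0 : ℝ) < u := by rw [hu, neg_sq]; positivity
    rintro rfl; simp at this
  have G := mixEntropy_sub_le_aux μ hs hrne hρne hune (by rw [hr]; ring) hu
  rw [integral_log_gaussVecPDF_mixMeasure _ hune hρne, gaussEntropy] at G
  have hc : (0 : ℝ) < Fintype.card ι := by simp [Fintype.card_pos]
  have hpow : (∑ i, ∑ t, ((1 - k) • μ i) t ^ 2) / Fintype.card ι ≤ (1 - k) ^ 2 * (n * Q) := by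
    rw [div_le_iff₀ hc]
    calc ∑ i, ∑ t, ((1 - k) • μ i) t ^ 2 = ∑ i, (1 - k) ^ 2 * ∑ t, μ i t ^ 2 := by
          simp only [Pi.smul_apply, smul_eq_mul, mul_pow, ← Finset.mul_sum]
      _ ≤ ∑ i : ι, (1 - k) ^ 2 * (n * Q) :=
          Finset.sum_le_sum fun i _ => mul_le_mul_of_nonneg_left (hμ i) (sq_nonneg _)
      _ = _ := by simp [mul_comm]
  have h1k : (1 - k) * (Q + 1) = r := by rw [hk, hr]; field_simp; ring
  have hkQ : k * (Q + 1) = Q + s := by rw [hk]; field_simp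
  -- At full power the error energy is exactly `n * ρ`, so the quadratic term of the Gaussian
  -- log-density is at most n/2.
  have hsum : (1 - k) ^ 2 * (n * Q) + n * u = n * ρ := by
    rw [hu, hρ, ← h1k]
    linear_combination (n : ℝ) * (1 - k) ^ 2 * (-hkQ)
  have hbd : ((∑ i, ∑ t, ((1 - k) • μ i) t ^ 2) / Fintype.card ι + n * u) / (2 * ρ) ≤ n / 2 := by
    rw [div_le_iff₀ (by positivity)]
    linarith
  have hl : Real.log (2 * Real.pi * ρ) = Real.log k + Real.log (2 * Real.pi * r) := by
    rw [hρ, ← Real.log_mul hk0.ne' (by positivity)]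
    congr 1; ring
  rw [hl] at G
  linarith

end mix

/-- The variance of an independent sum is the sum of the variances, each at most a second moment.
Centring is essential: without it the cross term of the two means would survive, since codebooks
need not have mean zero. -/
lemma sum_sum_sq_add_sub_mean_le {ι κ : Type*} [Fintype ι] [Fintype κ] [Nonempty ι] [Nonempty κ]
    (u : ι → ℝ) (v : κ → ℝ) :
    ∑ i, ∑ j, (u i + v j - ((∑ i, u i) / Fintype.card ι + (∑ j, v j) / Fintype.card κ)) ^ 2 ≤
      Fintype.card κ * ∑ i, u i ^ 2 + Fintype.card ι * ∑ j, v j ^ 2 := by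
  have ha : (0 : ℝ) < Fintype.card ι := by simp [Fintype.card_pos]
  have hb : (0 : ℝ) < Fintype.card κ := by simp [Fintype.card_pos]
  set a : ℝ := (Fintype.card ι : ℝ) with hae
  set b : ℝ := (Fintype.card κ : ℝ) with hbe
  set U := (∑ i, u i) / a with hU
  set V := (∑ j, v j) / b with hV
  have hU' : ∑ i, u i = a * U := by rw [hU]; field_simp
  have hV' : ∑ j, v j = b * V := by rw [hV]; field_simp
  have e : ∀ i j, (u i + v j - (U + V)) ^ 2 =
      (u i ^ 2 - 2 * U * u i + U ^ 2) + (v j ^ 2 - 2 * V * v j + V ^ 2) +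
        2 * (u i - U) * (v j - V) := fun i j => by ring
  have e2 : ∑ i, ∑ j, 2 * (u i - U) * (v j - V) = 0 := by
    have : ∑ j, (v j - V) = 0 := by
      rw [Finset.sum_sub_distrib, hV']; simp [← hbe]
    simp_rw [← Finset.mul_sum, this]
    simp
  simp_rw [e, Finset.sum_add_distrib, e2, Finset.sum_sub_distrib, ← Finset.mul_sum, hV']
  simp only [Finset.sum_const, Finset.card_univ, nsmul_eq_mul, ← hae, ← hbe, ← Finset.mul_sum, hU']
  nlinarith [mul_nonneg (mul_nonneg ha.le hb.le) (sq_nonneg U),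
    mul_nonneg (mul_nonneg ha.le hb.le) (sq_nonneg V)]

/-! ### Entropy inequalities for a fixed code -/

namespace GICCode

variable {n M₁ M₂ : ℕ} {P : ℝ} (c : GICCode n M₁ M₂ P) (g : ℝ)

/-- The code with the roles of the two users exchanged. -/
def swap : GICCode n M₂ M₁ P where
  enc₁ := c.enc₂
  enc₂ := c.enc₁
  power₁ := c.power₂
  power₂ := c.power₁
  dec₁ := c.dec₂
  dec₂ := c.dec₁
  measurable_dec₁ := c.measurable_dec₂
  measurable_dec₂ := c.measurable_dec₁

lemma avgError₁_swap : c.swap.avgError₁ g = c.avgError₂ g := by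
  unfold avgError₁ avgError₂ swap
  rw [Finset.sum_comm, mul_comm]

lemma sum_error₁ [NeZero M₁] [NeZero M₂] :
    ∑ i, ∑ j, (noiseLaw n).real {z | c.dec₁ (c.enc₁ i + (g • c.enc₂ j + z)) ≠ i} =
      M₁ * M₂ * c.avgError₁ g := by
  have h1 : (M₁ : ℝ) ≠ 0 := NeZero.ne _
  have h2 : (M₂ : ℝ) ≠ 0 := NeZero.ne _
  rw [avgError₁, mul_div_cancel₀ _ (mul_ne_zero h1 h2)]
  refine Finset.sum_congr rfl fun i _ => Finset.sum_congr rfl fun j _ => ?_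
  congr 1
  ext z
  have : c.enc₁ i + (g • c.enc₂ j + z) = fun t => c.enc₁ i t + g * c.enc₂ j t + z t := by
    ext t; simp [add_assoc]
  rw [Set.mem_ofPred_eq, Set.mem_ofPred_eq, this]

lemma sum_error₂ [NeZero M₁] [NeZero M₂] :
    ∑ i, ∑ j, (noiseLaw n).real {z | c.dec₂ (c.enc₂ j + (g • c.enc₁ i + z)) ≠ j} =
      M₁ * M₂ * c.avgError₂ g := by
  rw [Finset.sum_comm, ← c.avgError₁_swap, mul_comm (M₁ : ℝ)]
  exact c.swap.sum_error₁ g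

lemma avgError₁_nonneg : 0 ≤ c.avgError₁ g := by unfold avgError₁; positivity

lemma avgError₂_nonneg : 0 ≤ c.avgError₂ g := by unfold avgError₂; positivity

lemma measurableSet_dec₁_eq (i : Fin M₁) (a : Fin n → ℝ) :
    MeasurableSet {z | c.dec₁ (a + z) = i} :=
  (c.measurable_dec₁.comp (measurable_const_add a)) (measurableSet_singleton i)

lemma sum_success₁ [NeZero M₁] [NeZero M₂] :
    ∑ i, ∑ j, (gaussVec n 1).real {z | c.dec₁ (c.enc₁ i + (g • c.enc₂ j + z)) = i} =
      M₁ * M₂ * (1 - c.avgError₁ g) := by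
  have : ∀ i j, (gaussVec n 1).real {z | c.dec₁ (c.enc₁ i + (g • c.enc₂ j + z)) = i} =
      1 - (noiseLaw n).real {z | c.dec₁ (c.enc₁ i + (g • c.enc₂ j + z)) ≠ i} := by
    intro i j
    have hm : MeasurableSet {z | c.dec₁ (c.enc₁ i + (g • c.enc₂ j + z)) = i} := by
      simpa only [← add_assoc] using c.measurableSet_dec₁_eq i (c.enc₁ i + g • c.enc₂ j)
    have := probReal_compl_eq_one_sub (μ := gaussVec n 1) hm
    rw [noiseLaw_eq_gaussVec]
    change _ = 1 - (gaussVec n 1).real {z | c.dec₁ (c.enc₁ i + (g • c.enc₂ j + z)) = i}ᶜ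
    linarith
  simp_rw [this, Finset.sum_sub_distrib, c.sum_error₁ g]
  simp
  ring

lemma sum_sum_power_le [NeZero M₁] [NeZero M₂] :
    ∑ i, ∑ j, ∑ t, (c.enc₁ i t + g * c.enc₂ j t -
      ((∑ i, c.enc₁ i t) / M₁ + (∑ j, g * c.enc₂ j t) / M₂)) ^ 2 ≤
      M₁ * M₂ * (n * ((1 + g ^ 2) * P)) := by
  have h1 : ∀ t, ∑ i, ∑ j, (c.enc₁ i t + g * c.enc₂ j t -
      ((∑ i, c.enc₁ i t) / M₁ + (∑ j, g * c.enc₂ j t) / M₂)) ^ 2 ≤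
      M₂ * ∑ i, c.enc₁ i t ^ 2 + M₁ * ∑ j, (g * c.enc₂ j t) ^ 2 := fun t => by
    simpa using sum_sum_sq_add_sub_mean_le (fun i => c.enc₁ i t) (fun j => g * c.enc₂ j t)
  have h2 : ∑ i, ∑ t, c.enc₁ i t ^ 2 ≤ M₁ * (n * P) := by
    simpa using Finset.sum_le_sum fun i (_ : i ∈ Finset.univ) => c.power₁ i
  have h3 : ∑ j, ∑ t, (g * c.enc₂ j t) ^ 2 ≤ M₂ * (g ^ 2 * (n * P)) := by
    simp_rw [mul_pow, ← Finset.mul_sum]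
    have : ∑ j, ∑ t, c.enc₂ j t ^ 2 ≤ M₂ * (n * P) := by
      simpa using Finset.sum_le_sum fun i (_ : i ∈ Finset.univ) => c.power₂ i
    nlinarith [sq_nonneg g]
  calc _ = ∑ t, ∑ i, ∑ j, (c.enc₁ i t + g * c.enc₂ j t -
      ((∑ i, c.enc₁ i t) / M₁ + (∑ j, g * c.enc₂ j t) / M₂)) ^ 2 :=
        (Finset.sum_congr rfl fun i _ => Finset.sum_comm).trans Finset.sum_comm
    _ ≤ ∑ t, (M₂ * ∑ i, c.enc₁ i t ^ 2 + M₁ * ∑ j, (g * c.enc₂ j t) ^ 2) :=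
        Finset.sum_le_sum fun t _ => h1 t
    _ = M₂ * ∑ i, ∑ t, c.enc₁ i t ^ 2 + M₁ * ∑ j, ∑ t, (g * c.enc₂ j t) ^ 2 := by
        rw [Finset.sum_add_distrib, ← Finset.mul_sum, ← Finset.mul_sum, Finset.sum_comm,
          Finset.sum_comm (γ := Fin M₂)]
    _ ≤ _ := by
        have a1 := mul_le_mul_of_nonneg_left h2 (Nat.cast_nonneg (α := ℝ) M₂)
        have a2 := mul_le_mul_of_nonneg_left h3 (Nat.cast_nonneg (α := ℝ) M₁)
        linarith

/-- The bound on one user's rate from its receiver's own output alone. -/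
lemma log_mul_le_direct [NeZero M₁] [NeZero M₂] (hP : 0 ≤ P) :
    Real.log M₁ * (1 - c.avgError₁ g) ≤ gaussEntropy n ((1 + g ^ 2) * P + 1) -
      mixEntropy (fun j => g • c.enc₂ j) 1 + 1 := by
  have h1 : (0 : ℝ) < M₁ := by exact_mod_cast Nat.pos_of_neZero M₁
  have h2 : (0 : ℝ) < M₂ := by exact_mod_cast Nat.pos_of_neZero M₂
  set B : Fin M₂ → Fin n → ℝ := fun j => g • c.enc₂ j with hB
  obtain ⟨G, hG⟩ : ∃ G : ℝ≥0, (G : ℝ) = (1 + g ^ 2) * P + 1 :=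
    ⟨⟨(1 + g ^ 2) * P + 1, by positivity⟩, rfl⟩
  have hG0 : (0 : ℝ) < G := by rw [hG]; positivity
  have hGne : G ≠ 0 := by rintro rfl; simp at hG0
  -- The mean of the output. Centring the Gaussian comparison density here yields the power (1 +
  -- g²)P with no cross term.
  set w : Fin n → ℝ := fun t => (∑ i, c.enc₁ i t) / M₁ + (∑ j, g * c.enc₂ j t) / M₂ with hw
  have := isProbabilityMeasure_mixMeasure B (one_ne_zero (α := ℝ≥0))
  have i1 : ∀ m, Integrable (fun x => Real.log (gaussVecPDF G (c.enc₁ m + x - w)))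
      (mixMeasure B 1) := fun m => by
    refine integrable_mixMeasure _ one_ne_zero (by fun_prop) fun j => ?_
    have := integrable_log_gaussVecPDF hGne 1 (c.enc₁ m + B j - w)
    refine this.congr (Eventually.of_forall fun z => ?_)
    dsimp only
    congr 2; abel
  -- For user 1 the noise is interference plus thermal noise, whose law is a Gaussian mixture; a
  -- message only translates it.
  have F := fano_inequality (ι := Fin M₁) (ν := volume) (Γ := mixMeasure B 1) (p := mixPDF B 1)
    (q := fun y => gaussVecPDF G (y - w)) rfl (mixPDF_pos B one_ne_zero) (by fun_prop)
    (fun _ => gaussVecPDF_pos hGne _) (by fun_prop)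
    (by
      rw [lintegral_sub_right_eq_self (fun y => ENNReal.ofReal (gaussVecPDF G y)),
        lintegral_gaussVecPDF n hGne])
    (τ := fun m x => c.enc₁ m + x) (fun m => measurePreserving_add_left volume _)
    (D := fun m => {y | c.dec₁ y = m})
    (fun m => c.measurable_dec₁ (measurableSet_singleton m))
    (fun a b hab => Set.disjoint_left.2 fun y hy hy' => hab (hy.symm.trans hy'))
    (integrable_log_mixPDF_mixMeasure B B one_ne_zero one_ne_zero) i1
  have hsucc : ∀ m, (mixMeasure B 1).real ((fun x => c.enc₁ m + x) ⁻¹' {y | c.dec₁ y = m}) =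
      (∑ j, (gaussVec n 1).real {z | c.dec₁ (c.enc₁ m + (B j + z)) = m}) / M₂ := fun m => by
    have := measureReal_mixMeasure B one_ne_zero (c.measurableSet_dec₁_eq m (c.enc₁ m))
    rwa [Fintype.card_fin] at this
  have hq : ∀ m, ∫ x, Real.log (gaussVecPDF G (c.enc₁ m + x - w)) ∂mixMeasure B 1 =
      -(n / 2 * Real.log (2 * Real.pi * G)) - ((∑ j, ∑ t, (c.enc₁ m t + g * c.enc₂ j t -
      w t) ^ 2) / M₂ + n) / (2 * G) := fun m => by
    have e : ∀ j (z : Fin n → ℝ), c.enc₁ m + (B j + z) - w = (c.enc₁ m + B j - w) + z :=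
      fun j z => by abel
    rw [integral_mixMeasure B one_ne_zero (by fun_prop) fun j => by
      simp_rw [e]; exact integrable_log_gaussVecPDF hGne 1 _]
    simp_rw [e, integral_log_gaussVecPDF_add hGne]
    rw [Finset.sum_sub_distrib, ← Finset.sum_div, Finset.sum_add_distrib]
    simp [hB]
    field_simp
  rw [Finset.sum_sub_distrib] at F
  simp_rw [hsucc, hq] at F
  rw [← Finset.sum_div, c.sum_success₁ g] at F
  have hp : ∫ x, Real.log (mixPDF B 1 x) ∂mixMeasure B 1 = -mixEntropy B 1 := by simp [mixEntropy]
  rw [hp, Finset.sum_sub_distrib, ← Finset.sum_div, Finset.sum_add_distrib, ← Finset.sum_div] at F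
  simp only [Finset.sum_const, Finset.card_univ, Fintype.card_fin, nsmul_eq_mul] at F
  have hpow := c.sum_sum_power_le g
  have hS : ((∑ i, ∑ j, ∑ t, (c.enc₁ i t + g * c.enc₂ j t - w t) ^ 2) / M₂ + M₁ * n) / (2 * G) ≤
      M₁ * (n / 2) := by
    rw [div_le_iff₀ (by positivity), hG]
    have : (∑ i, ∑ j, ∑ t, (c.enc₁ i t + g * c.enc₂ j t - w t) ^ 2) / M₂ ≤
        M₁ * (n * ((1 + g ^ 2) * P)) := by
      rw [div_le_iff₀ h2]; linarith
    linarith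
  have e1 : Real.log M₁ * (M₁ * M₂ * (1 - c.avgError₁ g) / M₂) =
      M₁ * (Real.log M₁ * (1 - c.avgError₁ g)) := by field_simp
  rw [e1] at F
  rw [gaussEntropy, ← hG]
  refine le_of_mul_le_mul_left ?_ h1
  linarith

/-- The bound on one user's rate when its receiver also has a noisy view of the interference whose
noise is correlated with its own. -/
lemma log_mul_le_side_info [NeZero M₁] [NeZero M₂] (hg : g ≠ 0) {s : ℝ≥0}
    (hs : (s : ℝ) = 4 * g ^ 2 / (4 * g ^ 2 + 1)) :
    Real.log M₁ * (1 - c.avgError₁ g) ≤ mixEntropy (fun i => g • c.enc₁ i) s - gaussEntropy n s +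
      mixEntropy (fun j => g • c.enc₂ j) 1 - mixEntropy (fun j => g • c.enc₂ j) s + 1 := by
  have h1 : (0 : ℝ) < M₁ := by exact_mod_cast Nat.pos_of_neZero M₁
  have h2 : (0 : ℝ) < M₂ := by exact_mod_cast Nat.pos_of_neZero M₂
  have hg2 : 0 < g ^ 2 := by positivity
  have hs0 : (0 : ℝ) < s := by rw [hs]; positivity
  have hsne : s ≠ 0 := by rintro rfl; simp at hs0
  set A : Fin M₁ → Fin n → ℝ := fun i => g • c.enc₁ i with hA
  set B : Fin M₂ → Fin n → ℝ := fun j => g • c.enc₂ j with hB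
  have := isProbabilityMeasure_mixMeasure B hsne
  -- Here `x.1` is gX₂ + K and `x.2` is the genie noise N, both noises having variance `s`.
  have hΓ : (mixMeasure B s).prod (gaussVec n s) = (volume.prod volume).withDensity
      fun x => ENNReal.ofReal (mixPDF B s x.1 * gaussVecPDF s x.2) := by
    rw [mixMeasure, gaussVec_eq_withDensity n hsne, prod_withDensity_ofReal (by fun_prop)
      (mixPDF_pos B hsne) (by fun_prop)]
  -- This equation determines `s`: K ± N/(2g) must have variance 1. The plus sign is the channel
  -- noise, the minus sign the noise in Y₁ − S/g.
  have hvar : ((1 : ℝ≥0) : ℝ) = s + (-(2 * g)⁻¹) ^ 2 * s := by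
    rw [hs, NNReal.coe_one]; field_simp; ring
  have hvar' : ((1 : ℝ≥0) : ℝ) = s + ((2 * g)⁻¹) ^ 2 * s := by
    rw [hvar, neg_sq]
  have mW : MeasurePreserving (fun p : (Fin n → ℝ) × (Fin n → ℝ) => p.1 + (-(2 * g)⁻¹) • p.2)
      ((mixMeasure B s).prod (gaussVec n s)) (mixMeasure B 1) :=
    measurePreserving_add_smul_mixMeasure B hsne one_ne_zero hvar
  have mT : MeasurePreserving (fun p : (Fin n → ℝ) × (Fin n → ℝ) => p.1 + ((2 * g)⁻¹) • p.2)
      ((mixMeasure B s).prod (gaussVec n s)) (mixMeasure B 1) :=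
    measurePreserving_add_smul_mixMeasure B hsne one_ne_zero hvar'
  have i2 : Integrable (fun x => Real.log (gaussVecPDF s x)) (gaussVec n s) := by
    simpa using integrable_log_gaussVecPDF hsne s (0 : Fin n → ℝ)
  have j1 : Integrable (fun x : (Fin n → ℝ) × (Fin n → ℝ) => Real.log (mixPDF B s x.1))
      ((mixMeasure B s).prod (gaussVec n s)) :=
    (integrable_log_mixPDF_mixMeasure B B hsne hsne).comp_fst _
  have j2 : Integrable (fun x : (Fin n → ℝ) × (Fin n → ℝ) => Real.log (gaussVecPDF s x.2))
      ((mixMeasure B s).prod (gaussVec n s)) := i2.comp_snd _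
  have j3 : ∀ m, Integrable (fun x : (Fin n → ℝ) × (Fin n → ℝ) =>
      Real.log (mixPDF A s (A m + x.2))) ((mixMeasure B s).prod (gaussVec n s)) := fun m =>
    (integrable_log_mixPDF A hsne s (A m)).comp_snd _
  have j4 : Integrable (fun x : (Fin n → ℝ) × (Fin n → ℝ) =>
      Real.log (mixPDF B 1 (x.1 + (-(2 * g)⁻¹) • x.2))) ((mixMeasure B s).prod (gaussVec n s)) :=
    mW.integrable_comp_of_integrable
      (integrable_log_mixPDF_mixMeasure B B one_ne_zero one_ne_zero)
  have hlogp : ∀ x : (Fin n → ℝ) × (Fin n → ℝ),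
      Real.log (mixPDF B s x.1 * gaussVecPDF s x.2) =
        Real.log (mixPDF B s x.1) + Real.log (gaussVecPDF s x.2) := fun x =>
    Real.log_mul (mixPDF_pos B hsne _).ne' (gaussVecPDF_pos hsne _).ne'
  have hlogq : ∀ m, ∀ x : (Fin n → ℝ) × (Fin n → ℝ),
      Real.log (mixPDF A s (A m + x.2) * mixPDF B 1 (x.1 + (-(2 * g)⁻¹) • x.2)) =
        Real.log (mixPDF A s (A m + x.2)) +
          Real.log (mixPDF B 1 (x.1 + (-(2 * g)⁻¹) • x.2)) := fun m x =>
    Real.log_mul (mixPDF_pos A hsne _).ne' (mixPDF_pos B one_ne_zero _).ne'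
  have hτ : ∀ m, MeasurePreserving
      (fun x : (Fin n → ℝ) × (Fin n → ℝ) => (A m + x.2, x.1 + (-(2 * g)⁻¹) • x.2))
      (volume.prod volume) (volume.prod volume) := fun m => by
    have := (measurePreserving_shear (A m) 0 (-(2 * g)⁻¹)).comp Measure.measurePreserving_swap
    simpa [Function.comp_def] using this
  have F := fano_inequality (ι := Fin M₁) (q := fun y : (Fin n → ℝ) × (Fin n → ℝ) =>
      mixPDF A s y.1 * mixPDF B 1 y.2) hΓ
    (fun x => mul_pos (mixPDF_pos B hsne _) (gaussVecPDF_pos hsne _)) (by fun_prop)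
    (fun x => mul_pos (mixPDF_pos A hsne _) (mixPDF_pos B one_ne_zero _)) (by fun_prop)
    (lintegral_ofReal_mul_eq_one (by fun_prop) (mixPDF_pos A hsne) (by fun_prop)
      (lintegral_mixPDF A hsne) (lintegral_mixPDF B one_ne_zero)).le hτ
    -- The observation is (S, Y₁ − S/g), from which the decoder recovers Y₁.
    (D := fun m => {y | c.dec₁ (g⁻¹ • y.1 + y.2) = m})
    (fun m => (c.measurable_dec₁.comp (by fun_prop)) (measurableSet_singleton m))
    (fun a b hab => Set.disjoint_left.2 fun y hy hy' => hab (hy.symm.trans hy'))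
    (by simp_rw [hlogp]; exact j1.add j2)
    (fun m => by simp_rw [hlogq]; exact (j3 m).add j4)
  have hsucc : ∀ m, ((mixMeasure B s).prod (gaussVec n s)).real
      ((fun x : (Fin n → ℝ) × (Fin n → ℝ) => (A m + x.2, x.1 + (-(2 * g)⁻¹) • x.2)) ⁻¹'
        {y | c.dec₁ (g⁻¹ • y.1 + y.2) = m}) =
      (∑ j, (gaussVec n 1).real {z | c.dec₁ (c.enc₁ m + (B j + z)) = m}) / M₂ := fun m => by
    have hm := c.measurableSet_dec₁_eq m (c.enc₁ m)
    have h3 := measureReal_mixMeasure B one_ne_zero hm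
    rw [Fintype.card_fin] at h3
    refine Eq.trans ?_ h3
    rw [← mT.measureReal_preimage hm.nullMeasurableSet]
    congr 1
    ext x
    have : g⁻¹ • (A m + x.2) + (x.1 + (-(2 * g)⁻¹) • x.2) =
        c.enc₁ m + (x.1 + (2 * g)⁻¹ • x.2) := by
      ext t
      simp only [hA, Pi.add_apply, Pi.smul_apply, smul_eq_mul]
      field_simp
      ring
    simp only [Set.mem_preimage, Set.mem_ofPred_eq, this]
  simp_rw [hsucc, hlogp, hlogq] at F
  have e3 : ∀ m, ∫ x : (Fin n → ℝ) × (Fin n → ℝ), (Real.log (mixPDF A s (A m + x.2)) +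
      Real.log (mixPDF B 1 (x.1 + (-(2 * g)⁻¹) • x.2))) ∂((mixMeasure B s).prod (gaussVec n s)) =
      ∫ z, Real.log (mixPDF A s (A m + z)) ∂gaussVec n s - mixEntropy B 1 := fun m => by
    rw [integral_add (j3 m) j4,
      integral_fun_snd (fun z => Real.log (mixPDF A s (A m + z))),
      integral_comp_measurePreserving mW (F := fun x => Real.log (mixPDF B 1 x)) (by fun_prop)]
    simp [mixEntropy]
  have e4 : ∫ x : (Fin n → ℝ) × (Fin n → ℝ), (Real.log (mixPDF B s x.1) +
      Real.log (gaussVecPDF s x.2)) ∂((mixMeasure B s).prod (gaussVec n s)) =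
      -mixEntropy B s - gaussEntropy n s := by
    rw [integral_add j1 j2, integral_fun_fst (fun x => Real.log (mixPDF B s x)),
      integral_fun_snd (fun x => Real.log (gaussVecPDF s x)), integral_log_gaussVecPDF hsne]
    simp [mixEntropy]
    ring
  simp_rw [e3, e4] at F
  rw [← Finset.sum_div, c.sum_success₁ g, Finset.sum_sub_distrib, Finset.sum_sub_distrib,
    Finset.sum_sub_distrib,
    integral_log_mixPDF A hsne] at F
  simp only [Finset.sum_const, Finset.card_univ, Fintype.card_fin, nsmul_eq_mul] at F
  have e1 : Real.log M₁ * (M₁ * M₂ * (1 - c.avgError₁ g) / M₂) =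
      M₁ * (Real.log M₁ * (1 - c.avgError₁ g)) := by field_simp
  rw [e1] at F
  refine le_of_mul_le_mul_left ?_ h1
  linarith

/-- The union bound, averaged over message pairs. Only the two marginal error events enter, so the
noises at the two receivers may be coupled arbitrarily. -/
lemma sum_joint_success_ge [NeZero M₁] [NeZero M₂] {f : Fin M₁ → Fin M₂ → ℝ}
    (h : ∀ i j, 1 - (noiseLaw n).real {z | c.dec₁ (c.enc₁ i + (g • c.enc₂ j + z)) ≠ i} -
      (noiseLaw n).real {z | c.dec₂ (c.enc₂ j + (g • c.enc₁ i + z)) ≠ j} ≤ f i j) :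
    M₁ * M₂ * (1 - c.avgError₁ g - c.avgError₂ g) ≤ ∑ i, ∑ j, f i j := by
  have := Finset.sum_le_sum fun i (_ : i ∈ Finset.univ) =>
    Finset.sum_le_sum fun j (_ : j ∈ Finset.univ) => h i j
  simp_rw [Finset.sum_sub_distrib] at this
  rw [c.sum_error₁ g, c.sum_error₂ g] at this
  simp only [Finset.sum_const, Finset.card_univ, Fintype.card_fin, nsmul_eq_mul, mul_one] at this
  linarith

/-- The bound on the sum rate when both messages are decoded from a noisy view of `X₁` together
with the output of receiver 1. -/
lemma log_add_log_mul_le [NeZero M₁] [NeZero M₂] (hg : g ≠ 0) {v κ : ℝ≥0} (hv : v ≠ 0)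
    (hκ : κ ≠ 0) (hκv : (κ : ℝ) = 1 - v / (4 * g ^ 2)) (hκg : (κ : ℝ) ≤ g ^ 2) :
    (Real.log M₁ + Real.log M₂) * (1 - c.avgError₁ g - c.avgError₂ g) ≤
      mixEntropy (fun i => g • c.enc₁ i) v + mixEntropy (fun j => g • c.enc₂ j) 1 -
        gaussEntropy n v - gaussEntropy n κ + 1 := by
  have h1 : (0 : ℝ) < M₁ := by exact_mod_cast Nat.pos_of_neZero M₁
  have h2 : (0 : ℝ) < M₂ := by exact_mod_cast Nat.pos_of_neZero M₂
  have hg2 : 0 < g ^ 2 := by positivity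
  set A : Fin M₁ → Fin n → ℝ := fun i => g • c.enc₁ i with hA
  set B : Fin M₂ → Fin n → ℝ := fun j => g • c.enc₂ j with hB
  -- After X₁ and N are removed, X₂ is seen through noise K/g of variance κ/g². Independent noise
  -- scaled by `b` restores unit variance, so that the second decoder sees its own channel.
  set b : ℝ := √(1 - κ / g ^ 2) with hb
  have hb2 : b ^ 2 = 1 - κ / g ^ 2 := Real.sq_sqrt (by
    rw [sub_nonneg, div_le_one hg2]; exact hκg)
  -- The coordinates are the genie noise N, the remainder K of the channel noise, and the auxiliary
  -- noise that randomizes the simulation of receiver 2.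
  set Γ := ((gaussVec n v).prod (gaussVec n κ)).prod (gaussVec n 1) with hΓdef
  have hΓ : Γ = ((volume.prod volume).prod (gaussVec n 1)).withDensity
      fun x => ENNReal.ofReal (gaussVecPDF v x.1.1 * gaussVecPDF κ x.1.2) := by
    rw [hΓdef, gaussVec_eq_withDensity n hv, gaussVec_eq_withDensity n hκ,
      prod_withDensity_ofReal (by fun_prop) (gaussVecPDF_pos hv) (by fun_prop),
      prod_withDensity_left (by fun_prop)]
  have mK : MeasurePreserving (fun p : (Fin n → ℝ) × (Fin n → ℝ) =>
      (-(2 * g)⁻¹) • p.1 + (1 : ℝ) • p.2) ((gaussVec n v).prod (gaussVec n κ)) (gaussVec n 1) :=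
    measurePreserving_linearComb_gaussVec n (by
      rw [hκv, NNReal.coe_one]; field_simp; ring)
  have m1 : MeasurePreserving (fun x : ((Fin n → ℝ) × (Fin n → ℝ)) × (Fin n → ℝ) =>
      (2 * g)⁻¹ • x.1.1 + (1 : ℝ) • x.1.2) Γ (gaussVec n 1) :=
    (measurePreserving_linearComb_gaussVec n (by
      rw [hκv, NNReal.coe_one]; field_simp; ring)).comp measurePreserving_fst
  have m2 : MeasurePreserving (fun x : ((Fin n → ℝ) × (Fin n → ℝ)) × (Fin n → ℝ) =>
      g⁻¹ • x.1.2 + b • x.2) Γ (gaussVec n 1) :=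
    (measurePreserving_linearComb_gaussVec n (by
      rw [hb2, NNReal.coe_one]; field_simp; ring)).comp
      ((measurePreserving_snd (μ := gaussVec n v) (ν := gaussVec n κ)).prod
        (MeasurePreserving.id (gaussVec n 1)))
  have j1 : Integrable (fun x : ((Fin n → ℝ) × (Fin n → ℝ)) × (Fin n → ℝ) =>
      Real.log (gaussVecPDF v x.1.1)) Γ := by
    have : Integrable (fun x => Real.log (gaussVecPDF v x)) (gaussVec n v) := by
      simpa using integrable_log_gaussVecPDF hv v (0 : Fin n → ℝ)
    exact (this.comp_fst (gaussVec n κ)).comp_fst _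
  have j2 : Integrable (fun x : ((Fin n → ℝ) × (Fin n → ℝ)) × (Fin n → ℝ) =>
      Real.log (gaussVecPDF κ x.1.2)) Γ := by
    have : Integrable (fun x => Real.log (gaussVecPDF κ x)) (gaussVec n κ) := by
      simpa using integrable_log_gaussVecPDF hκ κ (0 : Fin n → ℝ)
    exact (this.comp_snd (gaussVec n v)).comp_fst _
  have j3 : ∀ i, Integrable (fun x : ((Fin n → ℝ) × (Fin n → ℝ)) × (Fin n → ℝ) =>
      Real.log (mixPDF A v (A i + x.1.1))) Γ := fun i =>
    ((integrable_log_mixPDF A hv v (A i)).comp_fst (gaussVec n κ)).comp_fst _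
  have m4 : MeasurePreserving (fun x : ((Fin n → ℝ) × (Fin n → ℝ)) × (Fin n → ℝ) =>
      (-(2 * g)⁻¹) • x.1.1 + (1 : ℝ) • x.1.2) Γ (gaussVec n 1) := mK.comp measurePreserving_fst
  have hshear : ∀ x : ((Fin n → ℝ) × (Fin n → ℝ)) × (Fin n → ℝ),
      x.1.2 + (-(2 * g)⁻¹) • x.1.1 = (-(2 * g)⁻¹) • x.1.1 + (1 : ℝ) • x.1.2 := fun x => by
    rw [one_smul, add_comm]
  have j4 : ∀ j, Integrable (fun x : ((Fin n → ℝ) × (Fin n → ℝ)) × (Fin n → ℝ) =>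
      Real.log (mixPDF B 1 (B j + (x.1.2 + (-(2 * g)⁻¹) • x.1.1)))) Γ := fun j => by
    simp_rw [hshear]
    exact m4.integrable_comp_of_integrable (integrable_log_mixPDF B one_ne_zero 1 (B j))
  have hlogp : ∀ x : ((Fin n → ℝ) × (Fin n → ℝ)) × (Fin n → ℝ),
      Real.log (gaussVecPDF v x.1.1 * gaussVecPDF κ x.1.2) =
        Real.log (gaussVecPDF v x.1.1) + Real.log (gaussVecPDF κ x.1.2) := fun x =>
    Real.log_mul (gaussVecPDF_pos hv _).ne' (gaussVecPDF_pos hκ _).ne'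
  have hlogq : ∀ y w : Fin n → ℝ, Real.log (mixPDF A v y * mixPDF B 1 w) =
      Real.log (mixPDF A v y) + Real.log (mixPDF B 1 w) := fun y w =>
    Real.log_mul (mixPDF_pos A hv _).ne' (mixPDF_pos B one_ne_zero _).ne'
  have hτ : ∀ m : Fin M₁ × Fin M₂, MeasurePreserving
      (fun x : ((Fin n → ℝ) × (Fin n → ℝ)) × (Fin n → ℝ) =>
        ((A m.1 + x.1.1, B m.2 + (x.1.2 + (-(2 * g)⁻¹) • x.1.1)), x.2))
      ((volume.prod volume).prod (gaussVec n 1)) ((volume.prod volume).prod (gaussVec n 1)) :=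
    fun m => (measurePreserving_shear (A m.1) (B m.2) (-(2 * g)⁻¹)).prod
      (MeasurePreserving.id (gaussVec n 1))
  -- The auxiliary noise is left in the reference measure, so it adds nothing to the entropies.
  have hmass : ∫⁻ y : ((Fin n → ℝ) × (Fin n → ℝ)) × (Fin n → ℝ),
      ENNReal.ofReal (mixPDF A v y.1.1 * mixPDF B 1 y.1.2)
        ∂((volume.prod volume).prod (gaussVec n 1)) ≤ 1 := by
    rw [(measurePreserving_fst (μ := (volume : Measure (Fin n → ℝ)).prod
      (volume : Measure (Fin n → ℝ))) (ν := gaussVec n 1)).lintegral_comp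
      (f := fun y : (Fin n → ℝ) × (Fin n → ℝ) =>
        ENNReal.ofReal (mixPDF A v y.1 * mixPDF B 1 y.2)) (by fun_prop)]
    exact (lintegral_ofReal_mul_eq_one (by fun_prop) (mixPDF_pos A hv) (by fun_prop)
      (lintegral_mixPDF A hv) (lintegral_mixPDF B one_ne_zero)).le
  -- Successive decoding: recover Y₁ and decode the first message, subtract X₁ and the now known
  -- N/(2g), divide by g, then add gX₁ and fresh noise to imitate Y₂.
  set D : Fin M₁ × Fin M₂ → Set (((Fin n → ℝ) × (Fin n → ℝ)) × (Fin n → ℝ)) := fun m =>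
    {y | c.dec₁ (g⁻¹ • y.1.1 + y.1.2) = m.1} ∩
      {y | c.dec₂ (g⁻¹ • (g⁻¹ • y.1.1 + y.1.2 - c.enc₁ m.1 -
        (2 * g)⁻¹ • (y.1.1 - g • c.enc₁ m.1)) + g • c.enc₁ m.1 + b • y.2) = m.2} with hDdef
  have hDm : ∀ m, MeasurableSet (D m) := fun m =>
    ((c.measurable_dec₁.comp (by fun_prop)) (measurableSet_singleton m.1)).inter
      ((c.measurable_dec₂.comp (by fun_prop)) (measurableSet_singleton m.2))
  have hDd : Pairwise (Function.onFun Disjoint D) := by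
    intro m m' hmm
    refine Set.disjoint_left.2 fun y hy hy' => hmm ?_
    -- The second condition depends on the first message through its codeword, so the first
    -- components must be identified before the second ones are compared.
    have e1 : m.1 = m'.1 := hy.1.symm.trans hy'.1
    refine Prod.ext e1 ?_
    have e2 := hy.2
    rw [e1] at e2
    exact e2.symm.trans hy'.2
  have F := fano_inequality (ι := Fin M₁ × Fin M₂)
    (q := fun y : ((Fin n → ℝ) × (Fin n → ℝ)) × (Fin n → ℝ) =>
      mixPDF A v y.1.1 * mixPDF B 1 y.1.2) hΓ
    (fun x => mul_pos (gaussVecPDF_pos hv _) (gaussVecPDF_pos hκ _)) (by fun_prop)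
    (fun x => mul_pos (mixPDF_pos A hv _) (mixPDF_pos B one_ne_zero _)) (by fun_prop)
    hmass hτ hDm hDd (by simp_rw [hlogp]; exact j1.add j2)
    (fun m => by simp_rw [hlogq]; exact (j3 m.1).add (j4 m.2))
  have hsucc : ∀ i j, 1 - (noiseLaw n).real {z | c.dec₁ (c.enc₁ i + (g • c.enc₂ j + z)) ≠ i} -
      (noiseLaw n).real {z | c.dec₂ (c.enc₂ j + (g • c.enc₁ i + z)) ≠ j} ≤
      Γ.real ((fun x : ((Fin n → ℝ) × (Fin n → ℝ)) × (Fin n → ℝ) =>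
        ((A i + x.1.1, B j + (x.1.2 + (-(2 * g)⁻¹) • x.1.1)), x.2)) ⁻¹' D (i, j)) := by
    intro i j
    have hc := probReal_compl_eq_one_sub (μ := Γ) ((hτ (i, j)).measurable (hDm (i, j)))
    have n1 : MeasurableSet {z | c.dec₁ (c.enc₁ i + (g • c.enc₂ j + z)) ≠ i} :=
      ((c.measurable_dec₁.comp (by fun_prop)) (measurableSet_singleton i)).compl
    have n2 : MeasurableSet {z | c.dec₂ (c.enc₂ j + (g • c.enc₁ i + z)) ≠ j} :=
      ((c.measurable_dec₂.comp (by fun_prop)) (measurableSet_singleton j)).compl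
    have hsub : ((fun x : ((Fin n → ℝ) × (Fin n → ℝ)) × (Fin n → ℝ) =>
        ((A i + x.1.1, B j + (x.1.2 + (-(2 * g)⁻¹) • x.1.1)), x.2)) ⁻¹' D (i, j))ᶜ ⊆
        (fun x => (2 * g)⁻¹ • x.1.1 + (1 : ℝ) • x.1.2) ⁻¹'
          {z | c.dec₁ (c.enc₁ i + (g • c.enc₂ j + z)) ≠ i} ∪
        (fun x => g⁻¹ • x.1.2 + b • x.2) ⁻¹'
          {z | c.dec₂ (c.enc₂ j + (g • c.enc₁ i + z)) ≠ j} := by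
      intro x hx
      have o1 : g⁻¹ • (A i + x.1.1) + (B j + (x.1.2 + (-(2 * g)⁻¹) • x.1.1)) =
          c.enc₁ i + (g • c.enc₂ j + ((2 * g)⁻¹ • x.1.1 + (1 : ℝ) • x.1.2)) := by
        ext t
        simp only [hA, hB, Pi.add_apply, Pi.smul_apply, smul_eq_mul]
        field_simp
        ring
      have o2 : g⁻¹ • (c.enc₁ i + (g • c.enc₂ j + ((2 * g)⁻¹ • x.1.1 + (1 : ℝ) • x.1.2)) -
          c.enc₁ i - (2 * g)⁻¹ • (A i + x.1.1 - g • c.enc₁ i)) + g • c.enc₁ i + b • x.2 =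
          c.enc₂ j + (g • c.enc₁ i + (g⁻¹ • x.1.2 + b • x.2)) := by
        ext t
        simp only [hA, Pi.add_apply, Pi.sub_apply, Pi.smul_apply, smul_eq_mul]
        field_simp
        ring
      simp only [Set.mem_union, Set.mem_preimage, Set.mem_ofPred_eq]
      by_contra! hcon
      refine hx ⟨?_, ?_⟩
      · simp only [Set.mem_ofPred_eq, o1]
        exact hcon.1
      · simp only [Set.mem_ofPred_eq, o1, o2]
        exact hcon.2
    have hle := (measureReal_mono (μ := Γ) hsub).trans (measureReal_union_le _ _)
    rw [m1.measureReal_preimage n1.nullMeasurableSet,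
      m2.measureReal_preimage n2.nullMeasurableSet] at hle
    rw [noiseLaw_eq_gaussVec]
    linarith
  have hsum := c.sum_joint_success_ge g hsucc
  have e4 : ∫ x, (Real.log (gaussVecPDF v x.1.1) + Real.log (gaussVecPDF κ x.1.2)) ∂Γ =
      -gaussEntropy n v - gaussEntropy n κ := by
    rw [integral_add j1 j2,
      integral_fun_fst (fun x : (Fin n → ℝ) × (Fin n → ℝ) => Real.log (gaussVecPDF v x.1)),
      integral_fun_fst (fun x : (Fin n → ℝ) × (Fin n → ℝ) => Real.log (gaussVecPDF κ x.2)),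
      integral_fun_fst (fun x => Real.log (gaussVecPDF v x)),
      integral_fun_snd (fun x => Real.log (gaussVecPDF κ x)), integral_log_gaussVecPDF hv,
      integral_log_gaussVecPDF hκ]
    simp
    ring
  have e3 : ∀ i j, ∫ x, (Real.log (mixPDF A v (A i + x.1.1)) +
      Real.log (mixPDF B 1 (B j + (x.1.2 + (-(2 * g)⁻¹) • x.1.1)))) ∂Γ =
      ∫ z, Real.log (mixPDF A v (A i + z)) ∂gaussVec n v +
        ∫ z, Real.log (mixPDF B 1 (B j + z)) ∂gaussVec n 1 := fun i j => by
    rw [integral_add (j3 i) (j4 j),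
      integral_fun_fst (fun x : (Fin n → ℝ) × (Fin n → ℝ) => Real.log (mixPDF A v (A i + x.1))),
      integral_fun_fst (fun x => Real.log (mixPDF A v (A i + x)))]
    simp_rw [hshear]
    rw [integral_comp_measurePreserving m4 (F := fun x => Real.log (mixPDF B 1 (B j + x)))
      (by fun_prop)]
    simp
  simp_rw [hlogp, hlogq, e4, e3, Fintype.sum_prod_type] at F
  simp_rw [Finset.sum_sub_distrib, Finset.sum_add_distrib] at F
  simp only [Finset.sum_const, Finset.card_univ, Fintype.card_fin, Fintype.card_prod,
    nsmul_eq_mul, ← Finset.mul_sum, integral_log_mixPDF A hv,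
    integral_log_mixPDF B (one_ne_zero (α := ℝ≥0))] at F
  push_cast at F
  rw [Real.log_mul h1.ne' h2.ne'] at F
  have hlog : 0 ≤ Real.log M₁ + Real.log M₂ := by positivity
  have hF := (mul_le_mul_of_nonneg_left hsum hlog).trans F
  refine le_of_mul_le_mul_left ?_ (mul_pos h1 h2)
  linarith

/-! ### Sum-rate bounds for a fixed code -/

/-- Two direct bounds plus the joint bound: h₂(1) cancels, and the surviving h₁(v) − h₁(1) is the
worst-noise gap at interference power g²P. -/
lemma two_mul_log_le_of_joint [NeZero M₁] [NeZero M₂] (hg : g ≠ 0) (hP : 0 ≤ P) {v κ : ℝ}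
    (hv : 0 < v) (hv1 : v ≤ 1) (hκ : 0 < κ) (hκv : κ = 1 - v / (4 * g ^ 2)) (hκg : κ ≤ g ^ 2) :
    2 * (Real.log M₁ + Real.log M₂) * (1 - c.avgError₁ g - c.avgError₂ g) ≤
      n * (Real.log ((1 + g ^ 2) * P + 1) - 1 / 2 * Real.log v - 1 / 2 * Real.log κ +
        1 / 2 * Real.log ((g ^ 2 * P + v) / (g ^ 2 * P + 1))) + 4 := by
  lift v to ℝ≥0 using hv.le
  lift κ to ℝ≥0 using hκ.le
  have hvne : v ≠ 0 := by rintro rfl; simp at hv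
  have hκne : κ ≠ 0 := by rintro rfl; simp at hκ
  have hl1 : 0 ≤ Real.log M₁ := Real.log_natCast_nonneg _
  have hl2 : 0 ≤ Real.log M₂ := Real.log_natCast_nonneg _
  have he1 := c.avgError₁_nonneg g
  have he2 := c.avgError₂_nonneg g
  have d1 := c.log_mul_le_direct g hP
  have d2 := c.swap.log_mul_le_direct g hP
  rw [c.avgError₁_swap] at d2
  have j := c.log_add_log_mul_le g hg hvne hκne hκv hκg
  have w := mixEntropy_sub_le (fun i => g • c.enc₁ i) hvne hv1 (Q := g ^ 2 * P) (by positivity)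
    (fun i => by
      simp only [Pi.smul_apply, smul_eq_mul, mul_pow, ← Finset.mul_sum]
      nlinarith [c.power₁ i, sq_nonneg g])
  have : c.swap.enc₂ = c.enc₁ := rfl
  rw [this] at d2
  have hG : 0 < (1 + g ^ 2) * P + 1 := by positivity
  have h2π : (0 : ℝ) < 2 * Real.pi := by positivity
  simp only [gaussEntropy] at d1 d2 j
  rw [Real.log_mul h2π.ne' hG.ne'] at d1 d2
  rw [Real.log_mul h2π.ne' hv.ne', Real.log_mul h2π.ne' hκ.ne'] at j
  -- Weakens each individual factor 1 − eᵢ to the common factor 1 − e₁ − e₂.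
  have t1 := mul_nonneg hl1 he2
  have t2 := mul_nonneg hl2 he1
  linarith

/-- Two direct and two genie-aided bounds: all mixture entropies cancel, leaving only Gaussian ones.
-/
lemma two_mul_log_le_of_side_info [NeZero M₁] [NeZero M₂] (hg : g ≠ 0) (hP : 0 ≤ P) :
    2 * (Real.log M₁ + Real.log M₂) * (1 - c.avgError₁ g - c.avgError₂ g) ≤
      n * (Real.log ((1 + g ^ 2) * P + 1) - Real.log (4 * g ^ 2 / (4 * g ^ 2 + 1))) + 4 := by
  obtain ⟨s, hs⟩ : ∃ s : ℝ≥0, (s : ℝ) = 4 * g ^ 2 / (4 * g ^ 2 + 1) :=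
    ⟨⟨4 * g ^ 2 / (4 * g ^ 2 + 1), by positivity⟩, rfl⟩
  have hs0 : (0 : ℝ) < s := by rw [hs]; positivity
  have hl1 : 0 ≤ Real.log M₁ := Real.log_natCast_nonneg _
  have hl2 : 0 ≤ Real.log M₂ := Real.log_natCast_nonneg _
  have he1 := c.avgError₁_nonneg g
  have he2 := c.avgError₂_nonneg g
  have d1 := c.log_mul_le_direct g hP
  have d2 := c.swap.log_mul_le_direct g hP
  have s1 := c.log_mul_le_side_info g hg hs
  have s2 := c.swap.log_mul_le_side_info g hg hs
  rw [c.avgError₁_swap] at d2 s2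
  have e1 : c.swap.enc₂ = c.enc₁ := rfl
  have e2 : c.swap.enc₁ = c.enc₂ := rfl
  rw [e1] at d2 s2
  rw [e2] at s2
  have hG : 0 < (1 + g ^ 2) * P + 1 := by positivity
  have h2π : (0 : ℝ) < 2 * Real.pi := by positivity
  simp only [gaussEntropy] at d1 d2 s1 s2
  rw [Real.log_mul h2π.ne' hG.ne'] at d1 d2
  rw [Real.log_mul h2π.ne' hs0.ne'] at s1 s2
  rw [← hs]
  have t1 := mul_nonneg hl1 he2
  have t2 := mul_nonneg hl2 he1
  linarith

end GICCode

/-! ### From fixed codes to the capacity region -/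

lemma le_log_messageCount (n : ℕ) {R : ℝ} (hR : 0 ≤ R) :
    messageCount n R ≠ 0 ∧
      n * R * Real.log 2 - Real.log 2 ≤ Real.log (messageCount n R) := by
  have h1 : (1 : ℝ) ≤ (2 : ℝ) ^ ((n : ℝ) * R) :=
    Real.one_le_rpow one_le_two (by positivity)
  have hpos : 1 ≤ messageCount n R := Nat.le_floor (by simpa using h1)
  refine ⟨by omega, ?_⟩
  have hlt : (2 : ℝ) ^ ((n : ℝ) * R) < messageCount n R + 1 := Nat.lt_floor_add_one _
  have hM : (1 : ℝ) ≤ messageCount n R := by exact_mod_cast hpos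
  -- A real number at least 1 loses at most a factor 2 under the floor, that is, log 2 nats.
  have h2 : (2 : ℝ) ^ ((n : ℝ) * R) / 2 ≤ messageCount n R := by linarith
  have h3 := Real.log_le_log (by positivity) h2
  rwa [Real.log_div (by positivity) two_ne_zero, Real.log_rpow two_pos] at h3

/-- A converse bound holding for every code at every block length bounds the achievable rates. -/
lemma GICAchievable.sum_le {g P R₁ R₂ C K : ℝ} (h : GICAchievable g P R₁ R₂)
    (hC : ∀ (n M₁ M₂ : ℕ) [NeZero M₁] [NeZero M₂] (c : GICCode n M₁ M₂ P),
      2 * (Real.log M₁ + Real.log M₂) * (1 - c.avgError₁ g - c.avgError₂ g) ≤ n * C + K) :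
    2 * (R₁ + R₂) * Real.log 2 ≤ C := by
  obtain ⟨hR1, hR2, c, ht1, ht2⟩ := h
  have hT : Tendsto (fun n => 1 - (c n).avgError₁ g - (c n).avgError₂ g) atTop (𝓝 1) := by
    simpa using (tendsto_const_nhds.sub ht1).sub ht2
  have hinv : Tendsto (fun n : ℕ => ((n : ℝ))⁻¹) atTop (𝓝 0) :=
    tendsto_inv_atTop_zero.comp tendsto_natCast_atTop_atTop
  have hl : Tendsto (fun n : ℕ => 2 * ((R₁ + R₂) * Real.log 2 - 2 * Real.log 2 * (n : ℝ)⁻¹) *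
      (1 - (c n).avgError₁ g - (c n).avgError₂ g)) atTop (𝓝 (2 * (R₁ + R₂) * Real.log 2)) := by
    have := ((tendsto_const_nhds (x := (R₁ + R₂) * Real.log 2)).sub
      (hinv.const_mul (2 * Real.log 2))).const_mul 2 |>.mul hT
    simpa [mul_assoc] using this
  have hr : Tendsto (fun n : ℕ => C + K * (n : ℝ)⁻¹) atTop (𝓝 C) := by
    simpa using (hinv.const_mul K).const_add C
  refine le_of_tendsto_of_tendsto hl hr ?_
  -- Positivity of 1 − e₁ − e₂ lets the lower bound on the message counts be multiplied through.
  filter_upwards [hT.eventually (lt_mem_nhds (zero_lt_one (α := ℝ))), eventually_gt_atTop 0]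
    with n hn hn0
  obtain ⟨a1, b1⟩ := le_log_messageCount n hR1
  obtain ⟨a2, b2⟩ := le_log_messageCount n hR2
  have : NeZero (messageCount n R₁) := ⟨a1⟩
  have : NeZero (messageCount n R₂) := ⟨a2⟩
  have hn' : (0 : ℝ) < n := by exact_mod_cast hn0
  have hc := hC n _ _ (c n)
  refine le_of_mul_le_mul_left ?_ hn'
  calc (n : ℝ) * (2 * ((R₁ + R₂) * Real.log 2 - 2 * Real.log 2 * (n : ℝ)⁻¹) *
      (1 - (c n).avgError₁ g - (c n).avgError₂ g)) =
      2 * ((n * R₁ * Real.log 2 - Real.log 2) + (n * R₂ * Real.log 2 - Real.log 2)) *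
        (1 - (c n).avgError₁ g - (c n).avgError₂ g) := by field_simp; ring
    _ ≤ 2 * (Real.log (messageCount n R₁) + Real.log (messageCount n R₂)) *
        (1 - (c n).avgError₁ g - (c n).avgError₂ g) := by gcongr
    _ ≤ n * C + K := hc
    _ = n * (C + K * (n : ℝ)⁻¹) := by field_simp

end

theorem mainTheorem6 (g P : ℝ) (hg_pos : 0 < g ^ 2) (hg_le : g ^ 2 ≤ 1) (hP : 0 ≤ P)
    (R₁ R₂ : ℝ) (hR : (R₁, R₂) ∈ gicCapacityRegion g P) :
    R₁ + R₂ ≤ rateSym g P +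
      min
        (1 / 4 * Real.logb 2 ((g ^ 2 * P + sigmaSq g) / (g ^ 2 * P + 1)) +
          1 / 4 * Real.logb 2 (4 * g ^ 4 / (sigmaSq g * (4 * g ^ 2 - sigmaSq g))))
        (1 / 2 * Real.logb 2 ((4 * g ^ 2 + 1) / (4 * |g|))) := by
  have hg : g ≠ 0 := by rintro rfl; simp at hg_pos
  have hga : 0 < |g| := abs_pos.2 hg
  have hG : 0 < (1 + g ^ 2) * P + 1 := by positivity
  have hsq : |g| ^ 2 = g ^ 2 := sq_abs g
  have hrate : rateSym g P * (2 * Real.log 2) =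
      Real.log ((1 + g ^ 2) * P + 1) - 1 / 2 * Real.log (g ^ 2) := by
    have e : |g| * P + |g|⁻¹ * (P + 1) = ((1 + g ^ 2) * P + 1) / |g| := by
      rw [← hsq]; field_simp; ring
    have hl2 : Real.log 2 ≠ 0 := (Real.log_pos one_lt_two).ne'
    rw [rateSym, Real.logb, e, Real.log_div hG.ne' hga.ne', ← hsq, Real.log_pow]
    field_simp
    push_cast
    ring
  have hlog2 : 0 < Real.log 2 := Real.log_pos one_lt_two
  set v := sigmaSq g with hv
  -- For g² ≤ 1/2 the choice of σ² makes Var K = g² exactly, and σ² ≤ 1 is (2g² − 1)² ≥ 0. For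
  -- larger g² the choice is σ² = 1, and the same square gives Var K ≤ g².
  obtain ⟨hv0, hv1, hκ0, hκg⟩ : 0 < v ∧ v ≤ 1 ∧ 0 < 1 - v / (4 * g ^ 2) ∧
      1 - v / (4 * g ^ 2) ≤ g ^ 2 := by
    rw [hv, sigmaSq]
    split_ifs with h
    · have e : 1 - 4 * g ^ 2 * (1 - g ^ 2) / (4 * g ^ 2) = g ^ 2 := by field_simp; ring
      rw [e]
      exact ⟨by nlinarith, by nlinarith [sq_nonneg (2 * g ^ 2 - 1)], hg_pos, le_rfl⟩
    · have h4 : (0 : ℝ) < 4 * g ^ 2 := by positivity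
      refine ⟨one_pos, le_rfl, ?_, ?_⟩
      · rw [sub_pos, div_lt_one h4]; linarith
      · rw [sub_le_iff_le_add, ← sub_le_iff_le_add', le_div_iff₀ h4]
        nlinarith [sq_nonneg (2 * g ^ 2 - 1)]
  have key : ∀ R ∈ {R : ℝ × ℝ | GICAchievable g P R.1 R.2}, R.1 + R.2 ≤ rateSym g P +
      min
        (1 / 4 * Real.logb 2 ((g ^ 2 * P + v) / (g ^ 2 * P + 1)) +
          1 / 4 * Real.logb 2 (4 * g ^ 4 / (v * (4 * g ^ 2 - v))))
        (1 / 2 * Real.logb 2 ((4 * g ^ 2 + 1) / (4 * |g|))) := by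
    intro R hR
    rw [← min_add_add_left, le_min_iff]
    constructor
    · have h := GICAchievable.sum_le hR fun n M₁ M₂ _ _ c =>
        c.two_mul_log_le_of_joint g hg hP hv0 hv1 hκ0 rfl hκg
      have e : 4 * g ^ 4 / (v * (4 * g ^ 2 - v)) = g ^ 2 / (v * (1 - v / (4 * g ^ 2))) := by
        have : 4 * g ^ 2 - v ≠ 0 := by
          intro h0
          rw [← sub_eq_zero.1 h0, div_self (by positivity)] at hκ0
          simp at hκ0
        field_simp
      refine le_of_mul_le_mul_right ?_ (mul_pos two_pos hlog2)
      rw [e, add_mul (rateSym g P), hrate]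
      simp only [Real.logb]
      rw [Real.log_div hg_pos.ne' (mul_pos hv0 hκ0).ne', Real.log_mul hv0.ne' hκ0.ne']
      refine le_of_eq_of_le (by ring) (h.trans (le_of_eq ?_))
      field_simp
      ring
    · have h := GICAchievable.sum_le hR fun n M₁ M₂ _ _ c =>
        c.two_mul_log_le_of_side_info g hg hP
      refine le_of_mul_le_mul_right ?_ (mul_pos two_pos hlog2)
      have h41 : 0 < 4 * g ^ 2 + 1 := by positivity
      have hlg : Real.log (g ^ 2) = 2 * Real.log |g| := by
        rw [← hsq, Real.log_pow]; norm_num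
      rw [Real.log_div (by positivity) h41.ne', Real.log_mul (by norm_num) hg_pos.ne', hlg] at h
      rw [add_mul (rateSym g P), hrate, Real.logb, Real.log_div h41.ne' (by positivity),
        Real.log_mul (by norm_num) hga.ne', hlg]
      refine le_of_eq_of_le (by ring) (h.trans (le_of_eq ?_))
      field_simp
      ring
  -- The bound cuts out a closed half-plane, so it passes to the closure.
  exact closure_minimal key (isClosed_le (f := fun R : ℝ × ℝ => R.1 + R.2)
    (continuous_fst.add continuous_snd) continuous_const) hR
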